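/- Let $n\ge 0$ and let $F_n$ be the free group on the ordered generators $A_1>\dots>A_n$. A word is called basic if it has the form $A_{i_1}A_{i_2}\cdots A_{i_k}$ with $k\ge 1$ and $i_1<i_2<\dots<i_k$; there are exactly $2^n-1$ basic words $X_1,\dots,X_{2^n-1}$. For a representation $\rho:F_n\to SL_2(\mathbb C)$ let $\chi_\rho:F_n\to\mathbb C$, $\chi_\rho(w)=\operatorname{tr}\rho(w)$, be its character, and let $\mathcal X_n$ be the set of all these characters, with the algebra of regular functions $\mathbb C[\mathcal X_n]$ generated by the trace functions $\chi\mapsto\chi(w)$, $w\in F_n$. Let $I_n\subset\mathbb Z[x_1,\dots,x_{2^n-1}]$ be the ideal of polynomials $p$ with $p(\chi(X_1),\dots,\chi(X_{2^n-1}))=0$ for all $\chi\in\mathcal X_n$, and let $V_{F_n}\subset\mathbb C^{2^n-1}$ be the common zero locus of the ideal $I_{n,\mathbb C}$ that $I_n$ generates in $\mathbb C[x_1,\dots,x_{2^n-1}]$. Then the map $h:\mathcal X_n\to\mathbb C^{2^n-1}$, $h(\chi)=(\chi(X_1),\dots,\chi(X_{2^n-1}))$, is injective with image exactly $V_{F_n}$,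 the set $V_{F_n}$ is an irreducible affine variety, and the algebra of restrictions of polynomials in $x_1,\dots,x_{2^n-1}$ to $V_{F_n}$ corresponds under $h$ to $\mathbb C[\mathcal X_n]$. Moreover, every $\sigma\in Out(F_n)$ induces a well-defined bijection $\widehat\sigma$ of $\mathcal X_n\cong V_{F_n}$, given by $\widehat\sigma(\chi)=\chi\circ\alpha$ for every automorphism $\alpha$ of $F_n$ representing $\sigma$. It is an automorphism of the variety (it and its inverse pull regular functions back to regular functions), and there is a polynomial automorphism $\Phi$ of $\mathbb C^{2^n-1}$ with $\Phi\circ h=h\circ\widehat\sigma$ whose Jacobian determinant is identically $1$ or identically $-1$. In particular $|\Phi^*\nu|=|\nu|$ for the standard complex volume form $\nu=\bigwedge_{i=1}^{2^n-1}dx_i$. -/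

import Mathlib

namespace FrickeCharacters

noncomputable section

/-- Index set of the basic words in the free group on `n` letters: a basic word is determined by
the nonempty set of generators occurring in it. -/
abbrev BasicIndex (n : ℕ) : Type := {S : Finset (Fin n) // S.Nonempty}

/-- The generators `A_0 > A_1 > ... > A_{n-1}` are `FreeGroup.of 0, ..., FreeGroup.of (n-1)`.
A word is basic if it is nonempty, all its letters are generators with exponent one, and each letter
is greater than the one after it (so the indices of the letters strictly increase). -/
def IsBasicWord {n : ℕ} (w : FreeGroup (Fin n)) : Prop :=
  ∃ l : List (Fin n), l ≠ [] ∧ l.Pairwise (· < ·) ∧ w = (l.map FreeGroup.of).prod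

/-- The basic word whose set of letters is `S`. -/
def basicWord {n : ℕ} (S : BasicIndex n) : FreeGroup (Fin n) :=
  ((S.1.sort (· ≤ ·)).map FreeGroup.of).prod

/-- The enumeration `basicWord` lists every basic word exactly once. -/
theorem basicWord_bijOn (n : ℕ) :
    Set.BijOn (basicWord (n := n)) Set.univ {w | IsBasicWord w} := by
  refine ⟨fun S _ => ?_, fun S _ T _ h => ?_, ?_⟩
  · refine ⟨S.1.sort (· ≤ ·), ?_, S.1.sortedLT_sort.pairwise, rfl⟩
    intro h0
    have h1 := S.1.length_sort (r := (· ≤ ·))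
    rw [h0] at h1
    exact S.2.card_pos.ne (by simpa using h1)
  · have key : ∀ l : List (Fin n), FreeGroup.toWord ((l.map FreeGroup.of).prod)
        = l.map (fun a => (a, true)) := by
      intro l
      have h1 : (l.map FreeGroup.of).prod = FreeGroup.mk (l.map (fun a => (a, true))) := by
        induction l with
        | nil => rfl
        | cons a t ih =>
          rw [List.map_cons, List.prod_cons, ih, FreeGroup.of, FreeGroup.mul_mk]
          rfl
      rw [h1, FreeGroup.toWord_mk]
      apply FreeGroup.IsReduced.reduce_eq
      exact List.Pairwise.isChain (List.pairwise_map.2 (List.pairwise_of_forall (fun _ _ _ => rfl)))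
    have h1 := key (S.1.sort (· ≤ ·))
    have h2 := key (T.1.sort (· ≤ ·))
    have h3 : (S.1.sort (· ≤ ·)).map (fun a => (a, true))
        = (T.1.sort (· ≤ ·)).map (fun a => (a, true)) := by
      rw [← h1, ← h2]
      exact congrArg FreeGroup.toWord h
    have h4 := List.map_injective_iff.2 (fun a b hab => (Prod.mk.inj hab).1) h3
    apply Subtype.ext
    rw [← S.1.sort_toFinset (r := (· ≤ ·)), h4, T.1.sort_toFinset]
  · rintro w ⟨l, hl, hs, rfl⟩
    refine ⟨⟨l.toFinset, List.toFinset_nonempty_iff l |>.2 hl⟩, trivial, ?_⟩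
    have h1 : l.toFinset.sort (· ≤ ·) = l :=
      (List.toFinset_sort (· ≤ ·) (hs.imp ne_of_lt)).2 (hs.imp le_of_lt)
    simp only [basicWord, h1]

/-- The outer automorphism group of the free group on `n` letters, as automorphisms modulo inner
automorphisms. -/
abbrev OuterAut (n : ℕ) : Type :=
  MulAut (FreeGroup (Fin n)) ⧸ (MulAut.conj (G := FreeGroup (Fin n))).range

/-- The inner automorphisms form a normal subgroup, so that `OuterAut n` is a group. -/
instance innerNormal (n : ℕ) : ((MulAut.conj (G := FreeGroup (Fin n))).range).Normal := by
  constructor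
  rintro _ ⟨g, rfl⟩ α
  refine ⟨α g, ?_⟩
  ext x
  simp

/-- The character `w ↦ tr (ρ w)` of a representation `ρ` of the free group in `SL₂(ℂ)`. -/
def character {n : ℕ} (ρ : FreeGroup (Fin n) →* Matrix.SpecialLinearGroup (Fin 2) ℂ) :
    FreeGroup (Fin n) → ℂ :=
  fun w => Matrix.trace (ρ w : Matrix (Fin 2) (Fin 2) ℂ)

/-- The set of all characters of representations of the free group in `SL₂(ℂ)`. -/
abbrev CharacterSet (n : ℕ) : Type :=
  {χ : FreeGroup (Fin n) → ℂ // ∃ ρ, character ρ = χ}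

/-- The algebra of regular functions on the set of characters: the complex algebra of functions
generated by the trace functions `tr_w : χ ↦ χ w` of all words `w`. -/
def characterRing (n : ℕ) : Subalgebra ℂ (CharacterSet n → ℂ) :=
  Algebra.adjoin ℂ (Set.range fun (w : FreeGroup (Fin n)) (χ : CharacterSet n) => χ.1 w)

/-- The Horowitz map: evaluation of a character at all the basic words. -/
def horowitz (n : ℕ) (χ : CharacterSet n) : BasicIndex n → ℂ :=
  fun S => χ.1 (basicWord S)

/-- The ideal of integer polynomials in the Horowitz generators that vanish identically on
characters. -/
def relationIdeal (n : ℕ) : Ideal (MvPolynomial (BasicIndex n) ℤ) :=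
  RingHom.ker (MvPolynomial.aeval
    (fun (S : BasicIndex n) (χ : CharacterSet n) => horowitz n χ S) :
      MvPolynomial (BasicIndex n) ℤ →ₐ[ℤ] (CharacterSet n → ℂ))

/-- The Fricke variety: the common zero locus in affine space of the complexification of the ideal
of relations. -/
def frickeVariety (n : ℕ) : Set (BasicIndex n → ℂ) :=
  MvPolynomial.zeroLocus ℂ
    ((relationIdeal n).map (MvPolynomial.map (σ := BasicIndex n) (Int.castRingHom ℂ)))

/-- `Z` is an irreducible affine variety in complex affine space: it is Zariski closed, nonempty and
not the union of two proper Zariski closed subsets. -/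
def IsIrreducibleAffineVariety {ι : Type} (Z : Set (ι → ℂ)) : Prop :=
  (∃ I : Ideal (MvPolynomial ι ℂ), Z = MvPolynomial.zeroLocus ℂ I) ∧
  Z.Nonempty ∧
  ∀ I J : Ideal (MvPolynomial ι ℂ),
    Z ⊆ MvPolynomial.zeroLocus ℂ I ∪ MvPolynomial.zeroLocus ℂ J →
      Z ⊆ MvPolynomial.zeroLocus ℂ I ∨ Z ⊆ MvPolynomial.zeroLocus ℂ J

/-- A bijection of the set of characters is an automorphism of varieties if it and its inverse pull
regular functions back to regular functions. -/
def IsVarietyAut {n : ℕ} (τ : Equiv.Perm (CharacterSet n)) : Prop :=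
  ∀ f : CharacterSet n → ℂ,
    (f ∈ characterRing n → f ∘ τ ∈ characterRing n) ∧
    (f ∈ characterRing n → f ∘ τ.symm ∈ characterRing n)

/-- The self-map of complex affine space given by an endomorphism of the polynomial ring, with
components `φ (X i)`. A polynomial automorphism is such a map for an algebra automorphism `φ`. -/
def polyMap {ι : Type} (φ : MvPolynomial ι ℂ →ₐ[ℂ] MvPolynomial ι ℂ) (x : ι → ℂ) : ι → ℂ :=
  fun i => MvPolynomial.eval x (φ (MvPolynomial.X i))

/-- The Jacobian determinant of `polyMap φ`, as a polynomial. -/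
def jacobianDet {ι : Type} [Fintype ι] [DecidableEq ι]
    (φ : MvPolynomial ι ℂ →ₐ[ℂ] MvPolynomial ι ℂ) : MvPolynomial ι ℂ :=
  Matrix.det (Matrix.of fun i j => MvPolynomial.pderiv j (φ (MvPolynomial.X i)))

/-- The standard complex volume form `⋀ dx_i`, a constant alternating form of top degree. -/
def standardVolume (ι : Type) [Fintype ι] [DecidableEq ι] : (ι → ℂ) [⋀^ι]→ₗ[ℂ] ℂ :=
  (Pi.basisFun ℂ ι).det

/-- `Φ` is complex differentiable and the pullback `Φ^* ν` of the standard volume form `ν` satisfies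
`|Φ^* ν| = |ν|` at every point. -/
def PreservesVolumeModulus {ι : Type} [Fintype ι] [DecidableEq ι]
    (Φ : (ι → ℂ) → (ι → ℂ)) : Prop :=
  Differentiable ℂ Φ ∧
  ∀ (x : ι → ℂ) (v : ι → ι → ℂ),
    ‖standardVolume ι (fun i => fderiv ℂ Φ x (v i))‖ = ‖standardVolume ι v‖

end

end FrickeCharacters

/-! Everything is transported to a polynomial ring in `4n` parameters. Over a field each matrix of
`SL₂` is a product of four unitriangular ones (`exists_unipProd`), so every representation is a
specialization of `genericRep`. The integral relations among the basic traces are therefore the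
kernel of `traceEval`, and irreducibility follows because pulled-back polynomials live in a domain.

Cayley–Hamilton and its polarization sort letters and remove repetitions, so the trace of any word
is an integer polynomial in basic traces (`tr_mk_mem`). This yields injectivity of the Horowitz map
and the description of the regular functions. For surjectivity, a point of the Fricke variety is a
ring homomorphism from the ring of generic traces to `ℂ`, and such a homomorphism is always a
character (`exists_rep_of_trace_hom`). If all trace values are `± 2`, the halved traces form a sign
character. Otherwise some element has distinct eigenvalues after specialization; diagonalizing it
puts the diagonal entries and the off-diagonal products in a local ring. Either all these products
specialize to zero and the diagonal gives a sum of two characters, or a rescaling makes all entries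
integral and the representation itself specializes.

An automorphism of the free group acts on the basic traces by polynomials, but these must be chosen
to form an automorphism of affine space. The automorphisms for which this is possible over `ℤ` form
a group, so generators suffice (`subgroup_eq_top_of_nielsen`). Signed permutations of the letters
act triangularly up to sign (`eqUpToSign_sortedWord`); the substitution `A₁ ↦ A₁A₂` has an explicit
lift, and the other transvections are conjugate to it by signed permutations. The Jacobian
determinant of an automorphism of `ℤ[x]` is a unit, hence `± 1`. Inner automorphisms fix every
character, so the action descends to outer automorphisms. -/

namespace FrickeCharacters

noncomputable section

open Matrix

/-! ### Trace identities in `SL₂` and reduction to basic words. -/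

section TraceTheorem

variable {n : ℕ} {A : Type*} [CommRing A]

/-- The increasing product of the generators in `U`; the empty product is `1`. -/
def sortedWord (U : Finset (Fin n)) : FreeGroup (Fin n) :=
  ((U.sort (· ≤ ·)).map FreeGroup.of).prod

lemma sortedWord_empty : sortedWord (∅ : Finset (Fin n)) = 1 := by
  simp [sortedWord]

lemma sortedWord_insert {a : Fin n} {s : Finset (Fin n)} (h : ∀ x ∈ s, a < x) :
    sortedWord (insert a s) = FreeGroup.of a * sortedWord s := by
  rw [sortedWord, Finset.sort_insert (h₁ := fun b hb => (h b hb).le) (h₂ := fun ha => lt_irrefl _ (h a ha))]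
  simp [sortedWord]

lemma sortedWord_singleton (a : Fin n) : sortedWord {a} = FreeGroup.of a := by
  simp [sortedWord]

lemma sortedWord_pair {a b : Fin n} (h : a < b) :
    sortedWord {a, b} = FreeGroup.of a * FreeGroup.of b := by
  rw [sortedWord_insert (by simpa using h), sortedWord_singleton]

/-- The trace of a word under a representation in `SL₂` over a commutative ring. -/
def tr (ρ : FreeGroup (Fin n) →* Matrix.SpecialLinearGroup (Fin 2) A) (w : FreeGroup (Fin n)) : A :=
  Matrix.trace (ρ w : Matrix (Fin 2) (Fin 2) A)

lemma cayley (M : Matrix.SpecialLinearGroup (Fin 2) A) :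
    (M : Matrix (Fin 2) (Fin 2) A) * M = M.1.trace • M.1 - 1 := by
  have h := M.2
  rw [Matrix.det_fin_two] at h
  ext i j
  fin_cases i <;> fin_cases j <;>
    simp [Matrix.mul_apply, Fin.sum_univ_two, Matrix.trace_fin_two] <;> grind

/-- Polarized Cayley–Hamilton: two adjacent letters may be interchanged at the cost of a sign and of
terms in which at least one of them has disappeared. -/
lemma cayley_polar (X Y : Matrix (Fin 2) (Fin 2) A) :
    Y * X = - (X * Y) + X.trace • Y + Y.trace • X
      + ((X * Y).trace - X.trace * Y.trace) • (1 : Matrix (Fin 2) (Fin 2) A) := by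
  ext i j
  fin_cases i <;> fin_cases j <;>
    simp [Matrix.mul_apply, Fin.sum_univ_two, Matrix.trace_fin_two] <;> ring

lemma sl_inv_eq (M : Matrix.SpecialLinearGroup (Fin 2) A) :
    ((M⁻¹ : Matrix.SpecialLinearGroup (Fin 2) A) : Matrix (Fin 2) (Fin 2) A)
      = M.1.trace • 1 - M.1 := by
  rw [Matrix.SpecialLinearGroup.coe_inv, adjugate_fin_two]
  ext i j
  fin_cases i <;> fin_cases j <;> simp [Matrix.trace_fin_two]

variable (ρ : FreeGroup (Fin n) →* Matrix.SpecialLinearGroup (Fin 2) A)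

lemma tr_one : tr ρ 1 = 2 := by simp [tr]

lemma tr_mul_comm (v w : FreeGroup (Fin n)) : tr ρ (v * w) = tr ρ (w * v) := by
  simp only [tr, map_mul, Matrix.SpecialLinearGroup.coe_mul]
  exact Matrix.trace_mul_comm _ _

lemma tr_conj (g w : FreeGroup (Fin n)) : tr ρ (g * w * g⁻¹) = tr ρ w := by
  rw [tr_mul_comm]; simp

lemma tr_inv (w : FreeGroup (Fin n)) : tr ρ w⁻¹ = tr ρ w := by
  simp only [tr, map_inv, sl_inv_eq]
  simp [Matrix.trace_fin_two]; ring

lemma tr_mul_inv (v w x : FreeGroup (Fin n)) :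
    tr ρ (v * w⁻¹ * x) = tr ρ w * tr ρ (v * x) - tr ρ (v * w * x) := by
  simp only [tr, map_mul, map_inv, Matrix.SpecialLinearGroup.coe_mul, sl_inv_eq]
  simp [Matrix.mul_sub, Matrix.sub_mul]

lemma tr_mul_swap (p a b q : FreeGroup (Fin n)) :
    tr ρ (p * (b * a) * q) = - tr ρ (p * (a * b) * q) + tr ρ a * tr ρ (p * b * q)
      + tr ρ b * tr ρ (p * a * q) + (tr ρ (a * b) - tr ρ a * tr ρ b) * tr ρ (p * q) := by
  simp only [tr, map_mul, Matrix.SpecialLinearGroup.coe_mul]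
  rw [cayley_polar (ρ a).1 (ρ b).1]
  simp [Matrix.mul_add, Matrix.add_mul]

/-- The subring generated by the traces of the basic words with letters in `T`. -/
def traceAlg (T : Finset (Fin n)) : Subalgebra ℤ A :=
  Algebra.adjoin ℤ {a | ∃ U : Finset (Fin n), U.Nonempty ∧ U ⊆ T ∧ a = tr ρ (sortedWord U)}

lemma tr_sortedWord_mem {T U : Finset (Fin n)} (h : U ⊆ T) :
    tr ρ (sortedWord U) ∈ traceAlg ρ T := by
  rcases U.eq_empty_or_nonempty with rfl | hU
  · rw [sortedWord_empty, tr_one]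
    exact (traceAlg ρ T).natCast_mem 2
  · exact Algebra.subset_adjoin ⟨U, hU, h, rfl⟩

lemma tr_of_mem {T : Finset (Fin n)} {a : Fin n} (h : a ∈ T) :
    tr ρ (FreeGroup.of a) ∈ traceAlg ρ T := by
  rw [← sortedWord_singleton]
  exact tr_sortedWord_mem ρ (by simpa using h)

lemma tr_pair_mem {T : Finset (Fin n)} {a b : Fin n} (hab : a < b) (h : a ∈ T) (h' : b ∈ T) :
    tr ρ (FreeGroup.of a * FreeGroup.of b) ∈ traceAlg ρ T := by
  rw [← sortedWord_pair hab]
  exact tr_sortedWord_mem ρ (by intro x; simp; rintro (rfl | rfl) <;> assumption)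

/-- The span of the images of the increasing words with letters in `U` over the trace ring of
`T`. -/
def basicSpan (T U : Finset (Fin n)) : Submodule (traceAlg ρ T) (Matrix (Fin 2) (Fin 2) A) :=
  Submodule.span (traceAlg ρ T)
    {M | ∃ V ⊆ U, M = (ρ (sortedWord V) : Matrix (Fin 2) (Fin 2) A)}

variable {ρ} in
lemma smul_mem_basicSpan {T U : Finset (Fin n)} {c : A} (hc : c ∈ traceAlg ρ T)
    {M : Matrix (Fin 2) (Fin 2) A} (hM : M ∈ basicSpan ρ T U) : c • M ∈ basicSpan ρ T U :=
  (basicSpan ρ T U).smul_mem (⟨c, hc⟩ : traceAlg ρ T) hM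

lemma basicSpan_mono {T U U' : Finset (Fin n)} (h : U ⊆ U') :
    basicSpan ρ T U ≤ basicSpan ρ T U' :=
  Submodule.span_mono (by rintro _ ⟨V, h1, rfl⟩; exact ⟨V, h1.trans h, rfl⟩)

lemma mem_basicSpan {T U V : Finset (Fin n)} (h : V ⊆ U) :
    (ρ (sortedWord V) : Matrix (Fin 2) (Fin 2) A) ∈ basicSpan ρ T U :=
  Submodule.subset_span ⟨V, h, rfl⟩

lemma mul_mem_basicSpan_of_forall {T U W : Finset (Fin n)} {N : Matrix (Fin 2) (Fin 2) A}
    (h : ∀ V ⊆ U, N * (ρ (sortedWord V) : Matrix (Fin 2) (Fin 2) A) ∈ basicSpan ρ T W)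
    {M : Matrix (Fin 2) (Fin 2) A} (hM : M ∈ basicSpan ρ T U) : N * M ∈ basicSpan ρ T W := by
  induction hM using Submodule.span_induction with
  | mem x hx => obtain ⟨V, hV, rfl⟩ := hx; exact h V hV
  | zero => simp
  | add x y _ _ hx hy => rw [mul_add]; exact add_mem hx hy
  | smul c x _ hx =>
    have : N * (c • x) = c • (N * x) := by
      rw [Matrix.mul_smul]
    rw [this]
    exact Submodule.smul_mem _ _ hx

/-- This is insertion sort: `j` is moved to the right past smaller letters by `cayley_polar` and
absorbed by `cayley` if it meets itself. Keeping track of the letter set `insert j U`, rather than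
only of `T`, is what lets the induction put the smallest letter back in front. -/
lemma of_mul_sortedWord_mem {T : Finset (Fin n)} {j : Fin n} (hj : j ∈ T) (U : Finset (Fin n))
    (hU : U ⊆ T) : (ρ (FreeGroup.of j) : Matrix (Fin 2) (Fin 2) A) * ρ (sortedWord U)
      ∈ basicSpan ρ T (insert j U) := by
  induction U using Finset.induction_on_min with
  | empty =>
    have := mem_basicSpan ρ (T := T) (subset_refl {j})
    rw [sortedWord_singleton] at this
    simpa [sortedWord_empty] using this
  | insert a s ha ih =>
    have haT : a ∈ T := hU (by simp)
    have hs : s ⊆ T := (Finset.subset_insert a s).trans hU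
    have hw : (ρ (sortedWord (insert a s)) : Matrix (Fin 2) (Fin 2) A)
        = ρ (FreeGroup.of a) * ρ (sortedWord s) := by
      rw [sortedWord_insert ha]; simp
    rcases lt_trichotomy j a with hja | rfl | hja
    · have h1 : ∀ x ∈ insert a s, j < x := by
        intro x hx
        rcases Finset.mem_insert.1 hx with rfl | hx
        · exact hja
        · exact hja.trans (ha x hx)
      have := mem_basicSpan ρ (T := T) (subset_refl (insert j (insert a s)))
      rw [sortedWord_insert h1] at this
      simpa using this
    · rw [hw, ← mul_assoc, cayley, Matrix.sub_mul, Matrix.smul_mul, ← hw, one_mul]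
      refine sub_mem (smul_mem_basicSpan (tr_of_mem ρ haT) (mem_basicSpan ρ ?_)) (mem_basicSpan ρ ?_)
      · simp
      · exact (Finset.subset_insert _ _).trans (Finset.subset_insert _ _)
    · have hsub : insert j s ⊆ insert j (insert a s) :=
        Finset.insert_subset_insert _ (Finset.subset_insert _ _)
      rw [hw, ← mul_assoc, cayley_polar (ρ (FreeGroup.of a)).1 (ρ (FreeGroup.of j)).1]
      simp only [Matrix.add_mul, Matrix.smul_mul, Matrix.neg_mul, one_mul]
      rw [← hw, mul_assoc]
      refine add_mem (add_mem (add_mem (neg_mem ?_) ?_) ?_) ?_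
      -- The induction hypothesis expands `j` times the tail in increasing words whose letters all
      -- exceed `a`, so prefixing `a` keeps them increasing.
      · refine mul_mem_basicSpan_of_forall ρ (fun V hV => ?_) (ih hs)
        have h1 : ∀ x ∈ V, a < x := by
          intro x hx
          rcases Finset.mem_insert.1 (hV hx) with rfl | hx
          · exact hja
          · exact ha x hx
        have := mem_basicSpan ρ (T := T) (subset_refl (insert a V))
        rw [sortedWord_insert h1] at this
        refine basicSpan_mono ρ (U := insert a V) ?_ (by simpa using this)
        rw [Finset.insert_comm]
        exact Finset.insert_subset_insert _ hV
      · exact smul_mem_basicSpan (tr_of_mem ρ haT) (basicSpan_mono ρ hsub (ih hs))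
      · exact smul_mem_basicSpan (tr_of_mem ρ hj) (mem_basicSpan ρ (Finset.subset_insert _ _))
      · refine smul_mem_basicSpan (sub_mem ?_ (mul_mem (tr_of_mem ρ haT) (tr_of_mem ρ hj)))
          (mem_basicSpan ρ ((Finset.subset_insert _ _).trans (Finset.subset_insert _ _)))
        have := tr_pair_mem ρ hja haT hj
        simpa [tr] using this

lemma of_mul_mem_basicSpan {T : Finset (Fin n)} {j : Fin n} (hj : j ∈ T)
    {M : Matrix (Fin 2) (Fin 2) A} (hM : M ∈ basicSpan ρ T T) :
    (ρ (FreeGroup.of j) : Matrix (Fin 2) (Fin 2) A) * M ∈ basicSpan ρ T T := by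
  refine mul_mem_basicSpan_of_forall ρ (fun V hV => ?_) hM
  exact basicSpan_mono ρ (by intro x; simp; rintro (rfl | h); exacts [hj, hV h])
    (of_mul_sortedWord_mem ρ hj V hV)

lemma mk_mem_basicSpan {T : Finset (Fin n)} (L : List (Fin n × Bool)) (hL : ∀ x ∈ L, x.1 ∈ T) :
    (ρ (FreeGroup.mk L) : Matrix (Fin 2) (Fin 2) A) ∈ basicSpan ρ T T := by
  induction L with
  | nil =>
    have := mem_basicSpan ρ (T := T) (Finset.empty_subset T)
    rwa [sortedWord_empty] at this
  | cons x L ih =>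
    obtain ⟨j, b⟩ := x
    have hj : j ∈ T := hL (j, b) (by simp)
    have ih' := ih (fun x hx => hL x (by simp [hx]))
    have h1 : FreeGroup.mk ((j, b) :: L) = FreeGroup.mk [(j, b)] * FreeGroup.mk L := by
      rw [FreeGroup.mul_mk]; rfl
    rw [h1, map_mul, Matrix.SpecialLinearGroup.coe_mul]
    cases b with
    | true => exact of_mul_mem_basicSpan ρ hj ih'
    | false =>
      have h2 : FreeGroup.mk [(j, false)] = (FreeGroup.of j)⁻¹ := by
        rw [FreeGroup.of, FreeGroup.inv_mk]; rfl
      rw [h2, map_inv, sl_inv_eq, Matrix.sub_mul, Matrix.smul_mul, one_mul]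
      exact sub_mem (smul_mem_basicSpan (tr_of_mem ρ hj) ih') (of_mul_mem_basicSpan ρ hj ih')

/-- The trace of a word is an integer polynomial in the traces of the basic words in the same
letters. -/
theorem tr_mk_mem {T : Finset (Fin n)} (L : List (Fin n × Bool)) (hL : ∀ x ∈ L, x.1 ∈ T) :
    tr ρ (FreeGroup.mk L) ∈ traceAlg ρ T := by
  have key : ∀ M ∈ basicSpan ρ T T, M.trace ∈ traceAlg ρ T := by
    intro M hM
    induction hM using Submodule.span_induction with
    | mem x hx => obtain ⟨V, hV, rfl⟩ := hx; exact tr_sortedWord_mem ρ hV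
    | zero => simp
    | add x y _ _ hx hy => rw [Matrix.trace_add]; exact add_mem hx hy
    | smul c x _ hx =>
      have : (c • x).trace = c.1 * x.trace := by
        rw [Matrix.trace_smul]; rfl
      rw [this]
      exact mul_mem c.2 hx
  exact key _ (mk_mem_basicSpan ρ L hL)

/-! ### Words in distinct signed letters, modulo lower traces. -/

/-- The subring generated by the traces of the basic words whose letters form a proper subset
of `T`. -/
def lowerAlg (T : Finset (Fin n)) : Subalgebra ℤ A :=
  Algebra.adjoin ℤ {a | ∃ U : Finset (Fin n), U.Nonempty ∧ U ⊂ T ∧ a = tr ρ (sortedWord U)}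

lemma traceAlg_le_lowerAlg {T U : Finset (Fin n)} (h : U ⊂ T) : traceAlg ρ U ≤ lowerAlg ρ T :=
  Algebra.adjoin_mono (by
    rintro _ ⟨V, h1, h2, rfl⟩; exact ⟨V, h1, Finset.ssubset_of_subset_of_ssubset h2 h, rfl⟩)

/-- The letters of a word. -/
def support (L : List (Fin n × Bool)) : Finset (Fin n) := (L.map Prod.fst).toFinset

lemma tr_mk_mem_lowerAlg {T : Finset (Fin n)} {L : List (Fin n × Bool)} (h : support L ⊂ T) :
    tr ρ (FreeGroup.mk L) ∈ lowerAlg ρ T :=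
  traceAlg_le_lowerAlg ρ h (tr_mk_mem ρ L (fun x hx => by
    simp only [support, List.mem_toFinset]; exact List.mem_map_of_mem hx))

/-- Equality up to sign modulo a subring. -/
def EqUpToSign (R : Subalgebra ℤ A) (a b : A) : Prop :=
  a - b ∈ R ∨ a + b ∈ R

lemma EqUpToSign.refl (R : Subalgebra ℤ A) (a : A) : EqUpToSign R a a := Or.inl (by simp)

lemma EqUpToSign.trans {R : Subalgebra ℤ A} {a b c : A} (h : EqUpToSign R a b)
    (h' : EqUpToSign R b c) : EqUpToSign R a c := by
  rcases h with h | h <;> rcases h' with h' | h'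
  · left; have := add_mem h h'; rwa [sub_add_sub_cancel] at this
  · right; have := add_mem h h'; rwa [show a - b + (b + c) = a + c by ring] at this
  · right; have := sub_mem h h'; rwa [show a + b - (b - c) = a + c by ring] at this
  · left; have := sub_mem h h'; rwa [show a + b - (b + c) = a - c by ring] at this

lemma mk_append (L L' : List (Fin n × Bool)) :
    FreeGroup.mk (L ++ L') = FreeGroup.mk L * FreeGroup.mk L' := (FreeGroup.mul_mk).symm

lemma mk_cons (x : Fin n × Bool) (L : List (Fin n × Bool)) :
    FreeGroup.mk (x :: L) = FreeGroup.mk [x] * FreeGroup.mk L := by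
  rw [FreeGroup.mul_mk]; rfl

lemma support_ssubset_of_sublist {L L' : List (Fin n × Bool)} (h : L.Sublist L')
    (hlen : L.length < L'.length) (hnd : (L'.map Prod.fst).Nodup) : support L ⊂ support L' := by
  refine Finset.ssubset_iff_subset_ne.2 ⟨fun x hx => ?_, fun he => ?_⟩
  · simp only [support, List.mem_toFinset] at hx ⊢
    exact (h.map _).subset hx
  · have h1 := congrArg Finset.card he
    rw [support, support, List.toFinset_card_of_nodup hnd,
      List.toFinset_card_of_nodup (hnd.sublist (h.map _))] at h1
    simp at h1
    omega

/-- Since `M + M⁻¹` is the scalar `tr M`, the two traces add up to a product of traces of words with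
fewer letters. A one-letter word is separate: there the trace of the inverse is the same trace, and
the sign is `+`. -/
lemma eqUpToSign_flip (P Q : List (Fin n × Bool)) (j : Fin n)
    (hnd : ((P ++ (j, true) :: Q).map Prod.fst).Nodup) :
    EqUpToSign (lowerAlg ρ (support (P ++ (j, true) :: Q)))
      (tr ρ (FreeGroup.mk (P ++ (j, false) :: Q))) (tr ρ (FreeGroup.mk (P ++ (j, true) :: Q))) := by
  have h2 : FreeGroup.mk [(j, false)] = (FreeGroup.mk [(j, true)])⁻¹ := by
    rw [FreeGroup.inv_mk]; rfl
  by_cases hPQ : P ++ Q = []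
  · obtain ⟨rfl, rfl⟩ := List.append_eq_nil_iff.1 hPQ
    left
    simp only [List.nil_append]
    rw [h2, tr_inv, sub_self]
    exact zero_mem _
  · right
    have h3 : tr ρ (FreeGroup.mk (P ++ (j, false) :: Q)) + tr ρ (FreeGroup.mk (P ++ (j, true) :: Q))
        = tr ρ (FreeGroup.mk [(j, true)]) * tr ρ (FreeGroup.mk (P ++ Q)) := by
      rw [mk_append, mk_append, mk_append, mk_cons, mk_cons (j, true), h2, ← mul_assoc, ← mul_assoc,
        tr_mul_inv]
      ring
    rw [h3]
    have hlen : 0 < (P ++ Q).length := List.length_pos_iff.2 hPQ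
    rw [List.length_append] at hlen
    refine mul_mem (tr_mk_mem_lowerAlg ρ ?_) (tr_mk_mem_lowerAlg ρ ?_)
    · refine support_ssubset_of_sublist (by simp) ?_ hnd
      simp; omega
    · refine support_ssubset_of_sublist ?_ (by simp) hnd
      exact List.Sublist.append (List.Sublist.refl P) (List.sublist_cons_self _ _)

/-- The correction terms of `tr_mul_swap` involve proper subsets of the letters as soon as a third
letter is present; for two letters the swap is cyclic invariance of the trace. -/
lemma eqUpToSign_swap (P Q : List (Fin n × Bool)) (x y : Fin n × Bool)
    (hnd : ((P ++ x :: y :: Q).map Prod.fst).Nodup) :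
    EqUpToSign (lowerAlg ρ (support (P ++ x :: y :: Q)))
      (tr ρ (FreeGroup.mk (P ++ y :: x :: Q))) (tr ρ (FreeGroup.mk (P ++ x :: y :: Q))) := by
  by_cases hPQ : P ++ Q = []
  · obtain ⟨rfl, rfl⟩ := List.append_eq_nil_iff.1 hPQ
    left
    simp only [List.nil_append]
    rw [mk_cons y [x], mk_cons x [y], tr_mul_comm, sub_self]
    exact zero_mem _
  · right
    have hlen : 0 < (P ++ Q).length := List.length_pos_iff.2 hPQ
    rw [List.length_append] at hlen
    have h3 : tr ρ (FreeGroup.mk (P ++ y :: x :: Q)) + tr ρ (FreeGroup.mk (P ++ x :: y :: Q))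
        = tr ρ (FreeGroup.mk [x]) * tr ρ (FreeGroup.mk (P ++ y :: Q))
          + tr ρ (FreeGroup.mk [y]) * tr ρ (FreeGroup.mk (P ++ x :: Q))
          + (tr ρ (FreeGroup.mk [x, y]) - tr ρ (FreeGroup.mk [x]) * tr ρ (FreeGroup.mk [y]))
            * tr ρ (FreeGroup.mk (P ++ Q)) := by
      simp only [mk_append]
      rw [mk_cons x [y], mk_cons y (x :: Q), mk_cons x (y :: Q), mk_cons x Q, mk_cons y Q]
      have := tr_mul_swap ρ (FreeGroup.mk P) (FreeGroup.mk [x]) (FreeGroup.mk [y]) (FreeGroup.mk Q)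
      simp only [mul_assoc] at this ⊢
      rw [this]
      ring
    rw [h3]
    have hx : tr ρ (FreeGroup.mk [x]) ∈ lowerAlg ρ (support (P ++ x :: y :: Q)) :=
      tr_mk_mem_lowerAlg ρ (support_ssubset_of_sublist (by simp) (by simp; omega) hnd)
    have hy : tr ρ (FreeGroup.mk [y]) ∈ lowerAlg ρ (support (P ++ x :: y :: Q)) :=
      tr_mk_mem_lowerAlg ρ (support_ssubset_of_sublist (by simp) (by simp; omega) hnd)
    refine add_mem (add_mem (mul_mem hx ?_) (mul_mem hy ?_))
      (mul_mem (sub_mem ?_ (mul_mem hx hy)) ?_) <;>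
      refine tr_mk_mem_lowerAlg ρ (support_ssubset_of_sublist ?_ ?_ hnd)
    · exact List.Sublist.append (List.Sublist.refl P) (List.sublist_cons_self _ _)
    · simp
    · exact List.Sublist.append (List.Sublist.refl P)
        ((List.sublist_cons_self _ _).cons_cons _)
    · simp
    · exact ((List.nil_sublist Q).cons_cons y |>.cons_cons x).trans (List.sublist_append_right _ _)
    · simp; omega
    · exact List.Sublist.append (List.Sublist.refl P)
        ((List.sublist_cons_self _ _).trans (List.sublist_cons_self _ _))
    · simp

lemma eqUpToSign_positive (P L : List (Fin n × Bool)) (hnd : ((P ++ L).map Prod.fst).Nodup) :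
    EqUpToSign (lowerAlg ρ (support (P ++ L))) (tr ρ (FreeGroup.mk (P ++ L)))
      (tr ρ (FreeGroup.mk (P ++ L.map fun x => (x.1, true)))) := by
  induction L generalizing P with
  | nil => exact EqUpToSign.refl _ _
  | cons x L ih =>
    obtain ⟨j, b⟩ := x
    have hs : support (P ++ (j, b) :: L) = support ((P ++ [(j, true)]) ++ L) := by
      simp [support]
    have h1 := ih (P ++ [(j, true)]) (by simpa using hnd)
    rw [← hs] at h1
    refine EqUpToSign.trans ?_ (by simpa using h1)
    cases b with
    | true => simpa using EqUpToSign.refl _ _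
    | false =>
      have h2 := eqUpToSign_flip ρ P L j (by simpa using hnd)
      have hs' : support (P ++ (j, true) :: L) = support (P ++ (j, false) :: L) := by
        simp [support]
      rw [hs'] at h2
      simpa using h2

lemma eqUpToSign_perm {L L' : List (Fin n × Bool)} (h : L.Perm L') (P : List (Fin n × Bool))
    (hnd : ((P ++ L).map Prod.fst).Nodup) :
    EqUpToSign (lowerAlg ρ (support (P ++ L))) (tr ρ (FreeGroup.mk (P ++ L)))
      (tr ρ (FreeGroup.mk (P ++ L'))) := by
  induction h generalizing P with
  | nil => exact EqUpToSign.refl _ _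
  | cons x _ ih =>
    have := ih (P ++ [x]) (by simpa using hnd)
    simpa using this
  | swap x y l =>
    have hp : (P ++ y :: x :: l).Perm (P ++ x :: y :: l) := (List.Perm.swap x y l).append_left P
    have := eqUpToSign_swap ρ P l x y ((hp.map Prod.fst).nodup_iff.1 hnd)
    have hs : support (P ++ y :: x :: l) = support (P ++ x :: y :: l) :=
      List.toFinset_eq_of_perm _ _ (hp.map Prod.fst)
    rwa [hs]
  | trans h1 h2 ih1 ih2 =>
    rename_i l1 l2 l3
    have hp := h1.append_left P
    have hs : support (P ++ l1) = support (P ++ l2) :=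
      List.toFinset_eq_of_perm _ _ (hp.map Prod.fst)
    refine (ih1 P hnd).trans ?_
    rw [hs]
    exact ih2 P ((hp.map Prod.fst).nodup_iff.1 hnd)

lemma sortedWord_eq_mk (U : Finset (Fin n)) :
    sortedWord U = FreeGroup.mk ((U.sort (· ≤ ·)).map fun i => (i, true)) := by
  rw [sortedWord]
  induction U.sort (· ≤ ·) with
  | nil => rfl
  | cons a l ih => rw [List.map_cons, List.prod_cons, ih, List.map_cons, mk_cons]; rfl

/-- The trace of a word in distinct signed letters agrees, up to sign and modulo traces of shorter
basic words, with the trace of the basic word in the same letters. -/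
theorem eqUpToSign_sortedWord (L : List (Fin n × Bool)) (hnd : (L.map Prod.fst).Nodup) :
    EqUpToSign (lowerAlg ρ (support L)) (tr ρ (FreeGroup.mk L)) (tr ρ (sortedWord (support L))) := by
  have h1 := eqUpToSign_positive ρ [] L hnd
  refine h1.trans ?_
  rw [sortedWord_eq_mk]
  have hp : (L.map fun x => (x.1, true)).Perm
      (((support L).sort (· ≤ ·)).map fun i => (i, true)) := by
    have : (L.map Prod.fst).Perm ((support L).sort (· ≤ ·)) := by
      refine (List.perm_ext_iff_of_nodup hnd (Finset.sort_nodup _ _)).2 (fun a => ?_)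
      simp [support]
    simpa [Function.comp_def] using this.map (fun i => (i, true))
  have h2 := eqUpToSign_perm ρ hp [] (by simpa [Function.comp_def] using hnd)
  have hs : support ([] ++ L.map fun x => (x.1, true)) = support ([] ++ L) := by
    simp [support, Function.comp_def]
  rw [hs] at h2
  exact h2

end TraceTheorem

end

end FrickeCharacters

namespace FrickeCharacters

noncomputable section

open Matrix

/-! ### Specializing representations along homomorphisms of their trace ring. -/

section Lifting

variable {K Ω : Type} [Field K] [Field Ω]

/-- A ring homomorphism from a subring of a field extends to the localization at its kernel. -/
lemma exists_extension_localization (R : Subring K) (φ : R →+* Ω) :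
    ∃ (R' : Subring K) (φ' : R' →+* Ω) (h : R ≤ R'), (∀ x : R, φ' ⟨x.1, h x.2⟩ = φ x) ∧
      ∀ x : R', φ' x ≠ 0 → x.1⁻¹ ∈ R' := by
  have hP : (RingHom.ker φ).IsPrime := RingHom.ker_isPrime φ
  let L := Localization.AtPrime (RingHom.ker φ)
  have hu : ∀ y : (RingHom.ker φ).primeCompl, IsUnit (φ y) := by
    rintro ⟨y, hy⟩
    exact isUnit_iff_ne_zero.2 hy
  have hv : ∀ y : (RingHom.ker φ).primeCompl, IsUnit (R.subtype y) := by
    rintro ⟨y, hy⟩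
    refine isUnit_iff_ne_zero.2 (fun h0 => hy ?_)
    have : y = 0 := Subtype.ext h0
    rw [this]
    exact zero_mem _
  let f : L →+* Ω := IsLocalization.lift hu
  let g : L →+* K := IsLocalization.lift hv
  -- Nothing is lost in passing to fractions inside the field `K`, so the localization is realized
  -- as the subring `g.range`.
  have hg : Function.Injective g := by
    rw [injective_iff_map_eq_zero]
    intro z hz
    obtain ⟨x, s, rfl⟩ := IsLocalization.exists_mk'_eq (RingHom.ker φ).primeCompl z
    rw [IsLocalization.lift_mk'] at hz
    have hx : (x : K) = 0 := by simpa using hz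
    have : x = 0 := Subtype.ext hx
    rw [this, IsLocalization.mk'_zero]
  let e : L ≃+* g.range := RingEquiv.ofBijective g.rangeRestrict
    ⟨fun a b hab => hg (congrArg Subtype.val hab), g.rangeRestrict_surjective⟩
  have hgR : ∀ x : R, g (algebraMap R L x) = x := fun x => IsLocalization.lift_eq hv x
  have hle : R ≤ g.range := fun x hx => ⟨algebraMap R L ⟨x, hx⟩, hgR ⟨x, hx⟩⟩
  refine ⟨g.range, f.comp e.symm.toRingHom, hle, fun x => ?_, ?_⟩
  · have h1 : e.symm ⟨x.1, hle x.2⟩ = algebraMap R L x := by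
      rw [RingEquiv.symm_apply_eq]
      exact Subtype.ext (hgR x).symm
    change f (e.symm ⟨x.1, hle x.2⟩) = φ x
    rw [h1]
    exact IsLocalization.lift_eq hu x
  · rintro ⟨_, z, rfl⟩ hz
    have h1 : e.symm ⟨g z, z, rfl⟩ = z := by
      rw [RingEquiv.symm_apply_eq]
      rfl
    change f (e.symm ⟨g z, z, rfl⟩) ≠ 0 at hz
    rw [h1] at hz
    obtain ⟨x, s, rfl⟩ := IsLocalization.exists_mk'_eq (RingHom.ker φ).primeCompl z
    have hx : x ∈ (RingHom.ker φ).primeCompl := by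
      intro hx
      apply hz
      rw [IsLocalization.lift_mk', (RingHom.mem_ker).1 hx, zero_mul]
    refine ⟨IsLocalization.mk' L s.1 ⟨x, hx⟩, ?_⟩
    refine eq_inv_of_mul_eq_one_left ?_
    rw [← map_mul, mul_comm]
    exact (congrArg g (IsLocalization.mk'_mul_mk'_eq_one' x s hx)).trans (map_one g)

lemma exists_lift_of_isIntegral [IsAlgClosed Ω] {C D : Type} [CommRing C] [CommRing D] [IsDomain C]
    [IsDomain D] [Algebra C D] [Algebra.IsIntegral C D] (φ : C →+* Ω) (hφ : Function.Injective φ)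
    (hCD : Function.Injective (algebraMap C D)) :
    ∃ ψ : D →+* Ω, ∀ x, ψ (algebraMap C D x) = φ x := by
  let _ : Algebra C Ω := φ.toAlgebra
  have h1 : FaithfulSMul C Ω := (faithfulSMul_iff_algebraMap_injective C Ω).2 hφ
  have h2 : FaithfulSMul C D := (faithfulSMul_iff_algebraMap_injective C D).2 hCD
  let ψ : D →ₐ[C] Ω := IsAlgClosed.lift
  exact ⟨ψ.toRingHom, ψ.commutes⟩

/-- A ring homomorphism into an algebraically closed field extends to an integral element. -/
lemma exists_extension_integral [IsAlgClosed Ω] (R : Subring K) (φ : R →+* Ω) (α : K)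
    (hα : IsIntegral R α) :
    ∃ (R' : Subring K) (φ' : R' →+* Ω) (h : R ≤ R'), (∀ x : R, φ' ⟨x.1, h x.2⟩ = φ x) ∧
      α ∈ R' := by
  have hP : (RingHom.ker φ).IsPrime := RingHom.ker_isPrime φ
  let B := integralClosure R K
  -- Lying over: modulo `Q` the integral closure is an integral extension of `R ⧸ ker φ`, and the
  -- embedding of the latter in `Ω` extends to it.
  obtain ⟨⟨Q, hQ, hQP⟩⟩ := Ideal.nonempty_primesOver (S := B) (RingHom.ker φ)
  obtain ⟨ψ, hψ⟩ := exists_lift_of_isIntegral (D := B ⧸ Q) (RingHom.kerLift φ)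
    (RingHom.kerLift_injective φ)
    ((faithfulSMul_iff_algebraMap_injective _ _).1 (Ideal.Quotient.instFaithfulSMul _ _))
  refine ⟨B.toSubring, ψ.comp (Ideal.Quotient.mk Q), fun x hx => ?_, fun x => ?_, hα⟩
  · exact (algebraMap R B ⟨x, hx⟩).2
  · exact hψ (Ideal.Quotient.mk _ x)

variable {G : Type} [Group G]

/-- A representation in `SL₂(K)` whose entries lie in a subring can be specialized along a
homomorphism of that subring. -/
lemma exists_specialization (R : Subring K) (φ : R →+* Ω)
    (ρ : G →* Matrix.SpecialLinearGroup (Fin 2) K) (h : ∀ g i j, (ρ g).1 i j ∈ R) :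
    ∃ ρ' : G →* Matrix.SpecialLinearGroup (Fin 2) Ω,
      ∀ g i j, (ρ' g).1 i j = φ ⟨(ρ g).1 i j, h g i j⟩ := by
  have hinj : Function.Injective (R.subtype.mapMatrix : Matrix (Fin 2) (Fin 2) R → _) := by
    intro M N hMN
    ext i j
    exact congrFun (congrFun hMN i) j
  let N : G → Matrix (Fin 2) (Fin 2) R := fun g => Matrix.of fun i j => ⟨(ρ g).1 i j, h g i j⟩
  have hN : ∀ g, R.subtype.mapMatrix (N g) = (ρ g).1 := fun g => by ext i j; rfl
  have hmul : ∀ a b, N (a * b) = N a * N b := fun a b => hinj (by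
    rw [map_mul, hN, hN, hN, map_mul]; rfl)
  let ρR : G →* Matrix.SpecialLinearGroup (Fin 2) R :=
    { toFun := fun g => ⟨N g, by
        apply R.subtype_injective
        rw [RingHom.map_det, hN]
        exact (ρ g).2.trans (map_one _).symm⟩
      map_one' := Subtype.ext (hinj (by rw [hN]; simp))
      map_mul' := fun a b => Subtype.ext (hmul a b) }
  exact ⟨(Matrix.SpecialLinearGroup.map φ).comp ρR, fun g i j => rfl⟩

/-- The conjugate of a representation in `SL₂` by an invertible matrix. -/
lemma exists_conj (ρ : G →* Matrix.SpecialLinearGroup (Fin 2) K) (P : Matrix (Fin 2) (Fin 2) K)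
    (hP : P.det ≠ 0) : ∃ ρ' : G →* Matrix.SpecialLinearGroup (Fin 2) K,
      ∀ g, (ρ' g).1 = P⁻¹ * (ρ g).1 * P := by
  have hu : IsUnit P.det := isUnit_iff_ne_zero.2 hP
  refine ⟨{ toFun := fun g => ⟨P⁻¹ * (ρ g).1 * P, ?_⟩, map_one' := ?_, map_mul' := ?_ },
    fun g => rfl⟩
  · rw [Matrix.det_mul, Matrix.det_mul, (ρ g).2, mul_one, ← Matrix.det_mul,
      Matrix.nonsing_inv_mul _ hu, Matrix.det_one]
  · apply Subtype.ext
    simp [Matrix.nonsing_inv_mul _ hu]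
  · intro a b
    apply Subtype.ext
    rw [map_mul]
    change P⁻¹ * ((ρ a).1 * (ρ b).1) * P = (P⁻¹ * (ρ a).1 * P) * (P⁻¹ * (ρ b).1 * P)
    simp only [mul_assoc]
    rw [← mul_assoc P P⁻¹, Matrix.mul_nonsing_inv _ hu, one_mul]

lemma trace_conj (P M : Matrix (Fin 2) (Fin 2) K) (hP : P.det ≠ 0) :
    (P⁻¹ * M * P).trace = M.trace := by
  rw [Matrix.trace_mul_comm, ← mul_assoc, Matrix.mul_nonsing_inv _ (isUnit_iff_ne_zero.2 hP),
    one_mul]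

/-- A matrix in `SL₂` with distinct eigenvalues is diagonalizable. -/
lemma exists_diagonalization (M : Matrix (Fin 2) (Fin 2) K) (hM : M.det = 1) (α β : K)
    (hαβ : α * β = 1) (htr : M.trace = α + β) (hne : α ≠ β) :
    ∃ P : Matrix (Fin 2) (Fin 2) K, P.det ≠ 0 ∧ P⁻¹ * M * P = !![α, 0; 0, β] := by
  have hev : ∀ γ δ : K, γ * δ = 1 → M.trace = γ + δ → ∃ v : Fin 2 → K, v ≠ 0 ∧ M *ᵥ v = γ • v := by
    intro γ δ h1 h2
    have hd : (M - γ • (1 : Matrix (Fin 2) (Fin 2) K)).det = 0 := by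
      rw [Matrix.det_fin_two] at hM ⊢
      rw [Matrix.trace_fin_two] at h2
      simp
      linear_combination hM - h1 - γ * h2
    obtain ⟨v, hv, hv'⟩ := Matrix.exists_mulVec_eq_zero_iff.2 hd
    refine ⟨v, hv, ?_⟩
    rw [Matrix.sub_mulVec, Matrix.smul_mulVec, Matrix.one_mulVec] at hv'
    exact sub_eq_zero.1 hv'
  obtain ⟨v, hv, hMv⟩ := hev α β hαβ htr
  obtain ⟨w, hw, hMw⟩ := hev β α (by rw [mul_comm]; exact hαβ) (by rw [htr]; ring)
  have v0 := congrFun hMv 0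
  have v1 := congrFun hMv 1
  have w0 := congrFun hMw 0
  have w1 := congrFun hMw 1
  simp [Matrix.mulVec, dotProduct, Fin.sum_univ_two] at v0 v1 w0 w1
  have hdet : (!![v 0, w 0; v 1, w 1]).det ≠ 0 := by
    rw [Matrix.det_fin_two_of]
    intro h0
    have hs : α - β ≠ 0 := sub_ne_zero.2 hne
    have e : ∀ i j, (α - β) * (v i * w j) = 0 := by
      rw [Fin.forall_fin_two, Fin.forall_fin_two, Fin.forall_fin_two]
      refine ⟨⟨?_, ?_⟩, ?_, ?_⟩
      · linear_combination -w 0 * v0 + v 0 * w0 - M 0 1 * h0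
      · linear_combination -w 1 * v0 + v 1 * w0 - (β - M 0 0) * h0
      · linear_combination -w 0 * v1 + v 0 * w1 + (β - M 1 1) * h0
      · linear_combination -w 1 * v1 + v 1 * w1 + M 1 0 * h0
    have hvw : ∀ i j, v i * w j = 0 := fun i j => (mul_eq_zero.1 (e i j)).resolve_left hs
    obtain ⟨i, hi⟩ := Function.ne_iff.1 hv
    obtain ⟨j, hj⟩ := Function.ne_iff.1 hw
    exact mul_ne_zero hi hj (hvw i j)
  refine ⟨!![v 0, w 0; v 1, w 1], hdet, ?_⟩
  have : M * !![v 0, w 0; v 1, w 1] = !![v 0, w 0; v 1, w 1] * !![α, 0; 0, β] := by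
    ext i j
    fin_cases i <;> fin_cases j <;> simp [Matrix.mul_apply, Fin.sum_univ_two] <;> grind
  rw [mul_assoc, this, ← mul_assoc, Matrix.nonsing_inv_mul _ (isUnit_iff_ne_zero.2 hdet), one_mul]

/-- A pseudo-representation with values `± 2` is the trace of a scalar representation. -/
lemma exists_scalar_rep [CharZero Ω] (R : Subring K) (φ : R →+* Ω)
    (ρ : G →* Matrix.SpecialLinearGroup (Fin 2) K) (hR : ∀ g, (ρ g).1.trace ∈ R)
    (h : ∀ g, φ ⟨(ρ g).1.trace, hR g⟩ ^ 2 = 4) :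
    ∃ ρ' : G →* Matrix.SpecialLinearGroup (Fin 2) Ω,
      ∀ g, (ρ' g).1.trace = φ ⟨(ρ g).1.trace, hR g⟩ := by
  set t : G → Ω := fun g => φ ⟨(ρ g).1.trace, hR g⟩ with ht
  have hadd : ∀ a b, t (a * b) + t (a * b⁻¹) = t a * t b := by
    intro a b
    simp only [ht]
    rw [← map_add, ← map_mul]
    congr 1
    apply Subtype.ext
    change (ρ (a * b)).1.trace + (ρ (a * b⁻¹)).1.trace = (ρ a).1.trace * (ρ b).1.trace
    rw [map_mul, map_mul, map_inv, Matrix.SpecialLinearGroup.coe_mul,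
      Matrix.SpecialLinearGroup.coe_mul, sl_inv_eq, Matrix.mul_sub, Matrix.trace_sub,
      Matrix.mul_smul, mul_one, Matrix.trace_smul, smul_eq_mul]
    ring
  have hpm : ∀ g, t g = 2 ∨ t g = -2 := fun g => by
    rw [← sq_eq_sq_iff_eq_or_eq_neg, h g]; norm_num
  have h2 : (2 : Ω) ≠ 0 := two_ne_zero
  have hmul : ∀ a b, t (a * b) * 2 = t a * t b := by
    intro a b
    have h1 := hadd a b
    -- Twice the sum of the squares of the two values is `16`, and the square of their sum is `(t
    -- a)² (t b)² = 16`; hence they coincide and `t / 2` is multiplicative.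
    have hsq : (t (a * b) - t (a * b⁻¹)) ^ 2 = 0 := by
      linear_combination 2 * h (a * b) + 2 * h (a * b⁻¹)
        - (t (a * b) + t (a * b⁻¹) + t a * t b) * h1 - t b ^ 2 * h a - 4 * h b
    linear_combination h1 + (pow_eq_zero_iff two_ne_zero).1 hsq
  have ht1 : t 1 = 2 := by
    have := hmul 1 1
    rw [mul_one] at this
    rcases hpm 1 with h1 | h1
    · exact h1
    · rw [h1] at this
      have h8 : (8 : Ω) ≠ 0 := by norm_num
      exact absurd (by linear_combination -this) h8
  let N : G → Matrix (Fin 2) (Fin 2) Ω := fun g => (t g / 2) • 1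
  have hN : ∀ g, (N g).trace = t g := fun g => by
    simp [N]
  refine ⟨{ toFun := fun g => ⟨N g, ?_⟩, map_one' := ?_, map_mul' := ?_ }, hN⟩
  · have := h g
    simp only [N, Matrix.det_smul, Matrix.det_one, Fintype.card_fin, mul_one]
    change t g ^ 2 = 4 at this
    rw [div_pow, this]
    norm_num
  · apply Subtype.ext
    change (t 1 / 2) • (1 : Matrix (Fin 2) (Fin 2) Ω) = 1
    rw [ht1, div_self h2, one_smul]
  · intro a b
    apply Subtype.ext
    change (t (a * b) / 2) • (1 : Matrix (Fin 2) (Fin 2) Ω) = ((t a / 2) • 1) * ((t b / 2) • 1)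
    rw [smul_mul_smul_comm, mul_one]
    congr 1
    have := hmul a b
    field_simp
    linear_combination this

/-- The specialization of the trace of a representation whose diagonal entries lie in a local
subring, in case the off-diagonal products specialize to zero. -/
lemma exists_diagonal_rep (R : Subring K) (φ : R →+* Ω)
    (ρ : G →* Matrix.SpecialLinearGroup (Fin 2) K) (h0 : ∀ g, (ρ g).1 0 0 ∈ R)
    (h1 : ∀ g, (ρ g).1 1 1 ∈ R) (hoff : ∀ a b, (ρ a).1 0 1 * (ρ b).1 1 0 ∈ R)
    (hzero : ∀ a b, φ ⟨_, hoff a b⟩ = 0) :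
    ∃ ρ' : G →* Matrix.SpecialLinearGroup (Fin 2) Ω,
      ∀ g, (ρ' g).1.trace = φ ⟨_, h0 g⟩ + φ ⟨_, h1 g⟩ := by
  have m0 : ∀ a b, φ ⟨_, h0 (a * b)⟩ = φ ⟨_, h0 a⟩ * φ ⟨_, h0 b⟩ := by
    intro a b
    rw [← map_mul, ← add_zero (φ (_ * _)), ← hzero a b, ← map_add]
    congr 1
    apply Subtype.ext
    change (ρ (a * b)).1 0 0 = (ρ a).1 0 0 * (ρ b).1 0 0 + (ρ a).1 0 1 * (ρ b).1 1 0
    rw [map_mul, Matrix.SpecialLinearGroup.coe_mul, Matrix.mul_apply, Fin.sum_univ_two]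
  have m1 : ∀ a b, φ ⟨_, h1 (a * b)⟩ = φ ⟨_, h1 a⟩ * φ ⟨_, h1 b⟩ := by
    intro a b
    rw [← map_mul, ← add_zero (φ (_ * _)), ← hzero b a, ← map_add]
    congr 1
    apply Subtype.ext
    change (ρ (a * b)).1 1 1 = (ρ a).1 1 1 * (ρ b).1 1 1 + (ρ b).1 0 1 * (ρ a).1 1 0
    rw [map_mul, Matrix.SpecialLinearGroup.coe_mul, Matrix.mul_apply, Fin.sum_univ_two]
    ring
  have md : ∀ a, φ ⟨_, h0 a⟩ * φ ⟨_, h1 a⟩ = 1 := by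
    intro a
    rw [← map_mul, ← sub_zero (φ (_ * _)), ← hzero a a, ← map_sub, ← map_one φ]
    congr 1
    apply Subtype.ext
    have := (ρ a).2
    rw [Matrix.det_fin_two] at this
    exact this
  have o0 : φ ⟨_, h0 1⟩ = 1 := by
    rw [← map_one φ]; congr 1; apply Subtype.ext; simp
  have o1 : φ ⟨_, h1 1⟩ = 1 := by
    rw [← map_one φ]; congr 1; apply Subtype.ext; simp
  refine ⟨{ toFun := fun g => ⟨!![φ ⟨_, h0 g⟩, 0; 0, φ ⟨_, h1 g⟩], ?_⟩, map_one' := ?_,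
            map_mul' := ?_ }, fun g => ?_⟩
  · rw [Matrix.det_fin_two_of, md]; simp
  · apply Subtype.ext
    change !![φ ⟨_, h0 1⟩, 0; 0, φ ⟨_, h1 1⟩] = 1
    rw [o0, o1, Matrix.one_fin_two]
  · intro a b
    apply Subtype.ext
    change !![φ ⟨_, h0 (a * b)⟩, 0; 0, φ ⟨_, h1 (a * b)⟩]
      = !![φ ⟨_, h0 a⟩, 0; 0, φ ⟨_, h1 a⟩] * !![φ ⟨_, h0 b⟩, 0; 0, φ ⟨_, h1 b⟩]
    rw [m0, m1, Matrix.mul_fin_two]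
    simp
  · change Matrix.trace !![φ ⟨_, h0 g⟩, 0; 0, φ ⟨_, h1 g⟩] = _
    simp [Matrix.trace_fin_two]

/-- Every homomorphism to an algebraically closed field from a ring containing the traces of a
representation in `SL₂` carries these traces to the traces of a representation. -/
theorem exists_rep_of_trace_hom [IsAlgClosed K] [IsAlgClosed Ω] [CharZero Ω]
    (R : Subring K) (φ : R →+* Ω)
    (ρ : G →* Matrix.SpecialLinearGroup (Fin 2) K) (hR : ∀ g, (ρ g).1.trace ∈ R) :
    ∃ ρ' : G →* Matrix.SpecialLinearGroup (Fin 2) Ω,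
      ∀ g, (ρ' g).1.trace = φ ⟨(ρ g).1.trace, hR g⟩ := by
  by_cases hall : ∀ g, φ ⟨(ρ g).1.trace, hR g⟩ ^ 2 = 4
  · exact exists_scalar_rep R φ ρ hR hall
  push Not at hall
  obtain ⟨a, ha⟩ := hall
  set t := (ρ a).1.trace with ht
  -- `α` and `t - α` are the eigenvalues of `ρ a`; they are integral over the trace ring, so `φ`
  -- extends to them.
  obtain ⟨α, hα⟩ : ∃ α : K, α ^ 2 - t * α + 1 = 0 := by
    have hd : (Polynomial.X ^ 2 - Polynomial.C t * Polynomial.X + 1 : Polynomial K).natDegree = 2 := by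
      compute_degree!
    obtain ⟨α, hα⟩ := IsAlgClosed.exists_root
      (Polynomial.X ^ 2 - Polynomial.C t * Polynomial.X + 1 : Polynomial K)
      (fun h => by rw [Polynomial.natDegree_eq_of_degree_eq_some h] at hd; simp at hd)
    exact ⟨α, by simpa using hα⟩
  have hint : IsIntegral R α := by
    refine ⟨Polynomial.X ^ 2 - Polynomial.C ⟨t, hR a⟩ * Polynomial.X + 1, ?_, ?_⟩
    · monicity!
    · simp [Polynomial.eval₂_add, Polynomial.eval₂_sub, Polynomial.eval₂_mul]
      exact hα
  obtain ⟨R₁, φ₁, hle₁, hφ₁, hα₁⟩ := exists_extension_integral R φ α hint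
  obtain ⟨R₂, φ₂, hle₂, hφ₂, hinv⟩ := exists_extension_localization R₁ φ₁
  have hle := hle₁.trans hle₂
  have hφ : ∀ x : R, φ₂ ⟨x.1, hle x.2⟩ = φ x := fun x => by
    rw [← hφ₁, ← hφ₂]
  have hα₂ : α ∈ R₂ := hle₂ hα₁
  have htr : ∀ g, (ρ g).1.trace ∈ R₂ := fun g => hle (hR g)
  have hβ₂ : t - α ∈ R₂ := sub_mem (htr a) hα₂
  have hαβ : α * (t - α) = 1 := by linear_combination -hα
  -- The squared eigenvalue difference is `t ^ 2 - 4`, which survives specialization by the choice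
  -- of `a`. So the difference is invertible in `R₂`.
  have hδ : φ₂ ⟨α - (t - α), sub_mem hα₂ hβ₂⟩ ≠ 0 := by
    intro h0
    apply ha
    have : φ₂ (⟨α - (t - α), sub_mem hα₂ hβ₂⟩ ^ 2) = φ₂ (⟨t, htr a⟩ ^ 2 - 4) := by
      congr 1
      apply Subtype.ext
      change (α - (t - α)) ^ 2 = t ^ 2 - 4
      linear_combination 4 * hα
    rw [map_pow, h0, map_sub, map_pow, hφ ⟨t, hR a⟩, map_ofNat] at this
    linear_combination -this
  have hδ₂ := hinv _ hδ
  have hδ0 : α - (t - α) ≠ 0 := by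
    intro h0
    apply hδ
    rw [← map_zero φ₂]
    congr 1
    exact Subtype.ext h0
  obtain ⟨P, hP, hPa⟩ := exists_diagonalization (ρ a).1 (ρ a).2 α (t - α) hαβ
    (by rw [← ht]; ring) (sub_ne_zero.1 hδ0)
  obtain ⟨ρ₁, hρ₁⟩ := exists_conj ρ P hP
  have htr₁ : ∀ g, (ρ₁ g).1.trace = (ρ g).1.trace := fun g => by
    rw [hρ₁, trace_conj _ _ hP]
  have ha₁ : (ρ₁ a).1 = !![α, 0; 0, t - α] := by rw [hρ₁, hPa]
  -- The traces of `g` and of `g * a` are two linear equations for the diagonal entries of `g`, with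
  -- determinant the eigenvalue difference up to sign.
  have h00 : ∀ g, (ρ₁ g).1 0 0 ∈ R₂ := by
    intro g
    have : (ρ₁ g).1 0 0 = ((ρ (g * a)).1.trace - (t - α) * (ρ g).1.trace) * (α - (t - α))⁻¹ := by
      rw [eq_mul_inv_iff_mul_eq₀ hδ0, ← htr₁, ← htr₁, map_mul, Matrix.SpecialLinearGroup.coe_mul, ha₁]
      simp [Matrix.trace_fin_two, Matrix.mul_apply, Fin.sum_univ_two]
      ring
    rw [this]
    exact mul_mem (sub_mem (htr _) (mul_mem hβ₂ (htr _))) hδ₂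
  have h11 : ∀ g, (ρ₁ g).1 1 1 ∈ R₂ := by
    intro g
    have : (ρ₁ g).1 1 1 = (ρ g).1.trace - (ρ₁ g).1 0 0 := by
      rw [← htr₁, Matrix.trace_fin_two]; ring
    rw [this]
    exact sub_mem (htr _) (h00 g)
  have hoff : ∀ g h, (ρ₁ g).1 0 1 * (ρ₁ h).1 1 0 ∈ R₂ := by
    intro g h
    have : (ρ₁ g).1 0 1 * (ρ₁ h).1 1 0 = (ρ₁ (g * h)).1 0 0 - (ρ₁ g).1 0 0 * (ρ₁ h).1 0 0 := by
      rw [map_mul, Matrix.SpecialLinearGroup.coe_mul, Matrix.mul_apply, Fin.sum_univ_two]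
      ring
    rw [this]
    exact sub_mem (h00 _) (mul_mem (h00 _) (h00 _))
  have hgoal : ∀ g, φ ⟨(ρ g).1.trace, hR g⟩ = φ₂ ⟨_, h00 g⟩ + φ₂ ⟨_, h11 g⟩ := by
    intro g
    rw [← hφ, ← map_add]
    congr 1
    apply Subtype.ext
    change (ρ g).1.trace = (ρ₁ g).1 0 0 + (ρ₁ g).1 1 1
    rw [← htr₁, Matrix.trace_fin_two]
  -- If all off-diagonal products vanish after specialization, each diagonal entry becomes
  -- multiplicative.
  by_cases hzero : ∀ g h, φ₂ ⟨_, hoff g h⟩ = 0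
  · obtain ⟨ρ', hρ'⟩ := exists_diagonal_rep R₂ φ₂ ρ₁ h00 h11 hoff hzero
    exact ⟨ρ', fun g => by rw [hρ', hgoal]⟩
  push Not at hzero
  obtain ⟨b, c, hbc⟩ := hzero
  have hbcinv := hinv _ hbc
  have hbc0 : (ρ₁ b).1 0 1 * (ρ₁ c).1 1 0 ≠ 0 := by
    intro h0
    apply hbc
    rw [← map_zero φ₂]
    congr 1
    exact Subtype.ext h0
  set q := (ρ₁ b).1 0 1 with hq
  have hq0 : q ≠ 0 := left_ne_zero_of_mul hbc0
  -- This divides upper right entries by `q` and multiplies lower left ones by `q`. The latter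
  -- become products covered by `hoff`; the former become such products divided by the invertible
  -- element `q * (ρ₁ c).1 1 0`.
  obtain ⟨ρ₂, hρ₂⟩ := exists_conj ρ₁ !![q, 0; 0, 1] (by simpa using hq0)
  have hqinv : (!![q, 0; 0, 1] : Matrix (Fin 2) (Fin 2) K)⁻¹ = !![q⁻¹, 0; 0, 1] := by
    apply Matrix.inv_eq_left_inv
    rw [Matrix.mul_fin_two, Matrix.one_fin_two]
    simp [hq0]
  have e : ∀ g, (ρ₂ g).1 = !![q⁻¹ * (ρ₁ g).1 0 0 * q, q⁻¹ * (ρ₁ g).1 0 1;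
      (ρ₁ g).1 1 0 * q, (ρ₁ g).1 1 1] := fun g => by
    rw [hρ₂, hqinv, Matrix.eta_fin_two (ρ₁ g).1]
    simp
  have e00 : ∀ g, (ρ₂ g).1 0 0 = (ρ₁ g).1 0 0 := fun g => by
    rw [e]; change q⁻¹ * (ρ₁ g).1 0 0 * q = _; field_simp
  have e01 : ∀ g, (ρ₂ g).1 0 1 = (ρ₁ g).1 0 1 * (ρ₁ c).1 1 0 * (q * (ρ₁ c).1 1 0)⁻¹ := fun g => by
    rw [e]; change q⁻¹ * (ρ₁ g).1 0 1 = _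
    have := right_ne_zero_of_mul hbc0
    field_simp
  have e10 : ∀ g, (ρ₂ g).1 1 0 = q * (ρ₁ g).1 1 0 := fun g => by
    rw [e]; exact mul_comm _ _
  have e11 : ∀ g, (ρ₂ g).1 1 1 = (ρ₁ g).1 1 1 := fun g => by
    rw [e]; rfl
  have hmem : ∀ g i j, (ρ₂ g).1 i j ∈ R₂ := by
    intro g
    rw [Fin.forall_fin_two, Fin.forall_fin_two, Fin.forall_fin_two, e00, e01, e10, e11]
    exact ⟨⟨h00 g, mul_mem (hoff g c) hbcinv⟩, hoff b g, h11 g⟩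
  obtain ⟨ρ', hρ'⟩ := exists_specialization R₂ φ₂ ρ₂ hmem
  refine ⟨ρ', fun g => ?_⟩
  rw [Matrix.trace_fin_two, hρ', hρ', hgoal]
  congr 2
  · exact Subtype.ext (e00 g)
  · exact Subtype.ext (e11 g)

end Lifting
end
end FrickeCharacters

namespace FrickeCharacters

noncomputable section

/-! ### Common prefixes of lists. -/

section CommonPrefix

variable {β : Type} [DecidableEq β]

/-- The length of the longest common prefix of two lists. -/
def commonPrefix : List β → List β → ℕ
  | a :: l, b :: m => if a = b then commonPrefix l m + 1 else 0
  | _, _ => 0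

lemma commonPrefix_comm (l m : List β) : commonPrefix l m = commonPrefix m l := by
  induction l generalizing m with
  | nil => cases m <;> rfl
  | cons a l ih =>
    cases m with
    | nil => rfl
    | cons b m => simp only [commonPrefix, ih m, eq_comm]

lemma commonPrefix_decomp (l m : List β) : ∃ p l' m', l = p ++ l' ∧ m = p ++ m' ∧
    p.length = commonPrefix l m ∧ ∀ x ∈ l'.head?, ∀ y ∈ m'.head?, x ≠ y := by
  induction l generalizing m with
  | nil => exact ⟨[], [], m, rfl, rfl, by cases m <;> rfl, by simp⟩
  | cons a l ih =>
    cases m with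
    | nil => exact ⟨[], a :: l, [], rfl, rfl, rfl, by simp⟩
    | cons b m =>
      by_cases h : a = b
      · subst h
        obtain ⟨p, l', m', h1, h2, h3, h4⟩ := ih m
        exact ⟨a :: p, l', m', by simp [h1], by simp [h2], by simp [commonPrefix, h3], h4⟩
      · exact ⟨[], a :: l, b :: m, rfl, rfl, by simp [commonPrefix, h], by simpa using h⟩

/-- The ultrametric inequality of the tree of words; it later compares the overlap with a product
and the overlap with its first factor. -/
lemma min_commonPrefix_le (l m k : List β) :
    min (commonPrefix l m) (commonPrefix m k) ≤ commonPrefix l k := by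
  induction l generalizing m k with
  | nil => cases m <;> simp [commonPrefix]
  | cons a l ih =>
    cases m with
    | nil => simp [commonPrefix]
    | cons b m =>
      cases k with
      | nil => simp [commonPrefix]
      | cons c k =>
        have := ih m k
        simp only [commonPrefix]
        split_ifs <;> simp_all

lemma prefix_of_le_commonPrefix {p l m : List β} (h : p <+: l) (hlen : p.length ≤ commonPrefix l m) :
    p <+: m := by
  obtain ⟨q, l', m', h1, h2, h3, -⟩ := commonPrefix_decomp l m
  have hq : q <+: l := ⟨l', h1.symm⟩
  exact (List.prefix_of_prefix_length_le h hq (by omega)).trans ⟨m', h2.symm⟩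

end CommonPrefix

/-! ### Cancellation in products of reduced words. -/

section Letters

variable {n : ℕ}

/-- The inverse letter. -/
def flipLetter (L : Fin n × Bool) : Fin n × Bool := (L.1, !L.2)

lemma eq_of_fst_eq_of_ne_flipLetter {L M : Fin n × Bool} (h : L.1 = M.1) (hne : M ≠ flipLetter L) : M = L := by
  obtain ⟨i, b⟩ := L
  obtain ⟨j, c⟩ := M
  simp only at h
  subst h
  cases b <;> cases c <;> simp_all [flipLetter]

/-- The group element given by a letter. -/
def letter (L : Fin n × Bool) : FreeGroup (Fin n) := FreeGroup.mk [L]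

lemma letter_flipLetter (L : Fin n × Bool) : letter (flipLetter L) = (letter L)⁻¹ := by
  rw [letter, letter, FreeGroup.inv_mk]; rfl

lemma letter_true (i : Fin n) : letter (i, true) = FreeGroup.of i := rfl

lemma letter_false (i : Fin n) : letter (i, false) = (FreeGroup.of i)⁻¹ :=
  letter_flipLetter (i, true)

lemma toWord_of_norm_mk {l : List (Fin n × Bool)} (h : (FreeGroup.mk l).norm = l.length) :
    (FreeGroup.mk l).toWord = l := by
  rw [FreeGroup.toWord_mk]
  have h1 : (FreeGroup.reduce l).Sublist l := (FreeGroup.reduce.red).sublist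
  refine h1.eq_of_length ?_
  rw [← FreeGroup.toWord_mk]
  exact h

/-- The overlap of two reduced words. -/
def overlap (g h : FreeGroup (Fin n)) : ℕ := commonPrefix g.toWord h.toWord

lemma overlap_comm (g h : FreeGroup (Fin n)) : overlap g h = overlap h g := commonPrefix_comm _ _

/-- Once the longest common prefix is removed, the remaining tails start with different letters, so
no further cancellation occurs at their junction. -/
lemma norm_inv_mul_add (g h : FreeGroup (Fin n)) :
    (g⁻¹ * h).norm + 2 * overlap g h = g.norm + h.norm := by
  obtain ⟨p, l, m, h1, h2, h3, h4⟩ := commonPrefix_decomp g.toWord h.toWord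
  have hg : g = FreeGroup.mk p * FreeGroup.mk l := by
    rw [FreeGroup.mul_mk, ← h1, FreeGroup.mk_toWord]
  have hh : h = FreeGroup.mk p * FreeGroup.mk m := by
    rw [FreeGroup.mul_mk, ← h2, FreeGroup.mk_toWord]
  have hgh : g⁻¹ * h = FreeGroup.mk (FreeGroup.invRev l ++ m) := by
    rw [hg, hh, mul_inv_rev, mul_assoc, inv_mul_cancel_left, FreeGroup.inv_mk, FreeGroup.mul_mk]
  have hl : FreeGroup.IsReduced l := by
    have : FreeGroup.IsReduced (p ++ l) := h1 ▸ FreeGroup.isReduced_toWord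
    exact (List.isChain_append.1 this).2.1
  have hm : FreeGroup.IsReduced m := by
    have : FreeGroup.IsReduced (p ++ m) := h2 ▸ FreeGroup.isReduced_toWord
    exact (List.isChain_append.1 this).2.1
  have hli : FreeGroup.IsReduced (FreeGroup.invRev l) := by
    rw [FreeGroup.isReduced_iff_reduce_eq, FreeGroup.reduce_invRev, hl.reduce_eq]
  have hred : FreeGroup.IsReduced (FreeGroup.invRev l ++ m) := by
    refine List.isChain_append.2 ⟨hli, hm, fun x hx y hy hxy => ?_⟩
    simp only [FreeGroup.invRev, List.getLast?_reverse, List.head?_map, Option.mem_def,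
      Option.map_eq_some_iff] at hx
    obtain ⟨z, hz, rfl⟩ := hx
    have := h4 z hz y hy
    by_contra hne
    apply this
    refine Prod.ext hxy ?_
    simpa using hne
  have hn : (g⁻¹ * h).norm = l.length + m.length := by
    rw [hgh, FreeGroup.norm, FreeGroup.toWord_mk, hred.reduce_eq, List.length_append,
      FreeGroup.invRev_length]
  have hng : g.norm = p.length + l.length := by rw [FreeGroup.norm, h1, List.length_append]
  have hnh : h.norm = p.length + m.length := by rw [FreeGroup.norm, h2, List.length_append]
  rw [hn, hng, hnh, overlap, ← h3]
  ring

lemma norm_mul_add (g h : FreeGroup (Fin n)) :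
    (g * h).norm + 2 * overlap g⁻¹ h = g.norm + h.norm := by
  have := norm_inv_mul_add g⁻¹ h
  rwa [inv_inv, FreeGroup.norm_inv_eq] at this

lemma min_overlap_le (g h k : FreeGroup (Fin n)) :
    min (overlap g h) (overlap h k) ≤ overlap g k := min_commonPrefix_le _ _ _

/-- Otherwise the first half of `g`, rounded up, would also begin `g⁻¹`. In even length `g` would
then be a word followed by its inverse; in odd length the middle letter would be its own inverse. -/
lemma overlap_inv_self_lt {g : FreeGroup (Fin n)} (hg : g ≠ 1) : 2 * overlap g⁻¹ g < g.norm := by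
  by_contra! hle
  set l := g.toWord with hl
  have hnorm : g.norm = l.length := rfl
  have hpos : 0 < l.length := by
    rw [← hnorm]; exact Nat.pos_of_ne_zero (fun h => hg (FreeGroup.norm_eq_zero.1 h))
  set k := (l.length + 1) / 2 with hk
  set p := l.take k with hp
  set s := l.drop k with hs
  have hps : l = p ++ s := (List.take_append_drop k l).symm
  have hplen : p.length = k := by rw [hp, List.length_take]; omega
  have hslen : s.length = l.length - k := by rw [hs, List.length_drop]
  have hpre : p <+: FreeGroup.invRev s ++ FreeGroup.invRev p := by
    rw [← FreeGroup.invRev_append, ← hps]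
    have : overlap g g⁻¹ = commonPrefix l (FreeGroup.invRev l) := by
      rw [overlap, FreeGroup.toWord_inv]
    refine prefix_of_le_commonPrefix ⟨s, hps.symm⟩ ?_
    rw [hplen, ← this, overlap_comm]
    omega
  have hpre2 : FreeGroup.invRev s <+: FreeGroup.invRev s ++ FreeGroup.invRev p := List.prefix_append _ _
  obtain ⟨t, ht⟩ := List.prefix_of_prefix_length_le hpre2 hpre (by
    rw [FreeGroup.invRev_length]; omega)
  have htlen : t.length = k - (l.length - k) := by
    have := congrArg List.length ht
    rw [List.length_append, FreeGroup.invRev_length, hplen, hslen] at this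
    omega
  have htpre : t <+: FreeGroup.invRev p := by
    have h : FreeGroup.invRev s ++ t <+: FreeGroup.invRev s ++ FreeGroup.invRev p := by
      rw [ht]; exact hpre
    exact (List.prefix_append_right_inj _).1 h
  match t, ht, htlen, htpre with
  | [], ht, htlen, htpre =>
    rw [List.append_nil] at ht
    apply hg
    rw [← FreeGroup.mk_toWord (x := g), ← hl, hps, ← ht, ← FreeGroup.mul_mk, ← FreeGroup.inv_mk,
      inv_mul_cancel]
  | [a], ht, htlen, htpre =>
    rw [← ht, FreeGroup.invRev_append] at htpre
    have := List.prefix_iff_eq_take.1 htpre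
    simp [FreeGroup.invRev] at this
    have h2 := congrArg Prod.snd this
    simp at h2
  | _ :: _ :: _, ht, htlen, htpre =>
    simp only [List.length_cons] at htlen
    omega

end Letters

/-! ### A tie-breaking order on words of equal length. -/

section Code

variable {n : ℕ}

/-- A numbering of the letters. -/
def letterCode (L : Fin n × Bool) : ℕ := Fintype.equivFin (Fin n × Bool) L

/-- A numbering of the words, lexicographic on words of the same length. -/
def code (l : List (Fin n × Bool)) : ℕ :=
  -- The reversal makes the first letter the most significant digit; `+ 2` keeps the base above one
  -- even without letters.
  Nat.ofDigits (Fintype.card (Fin n × Bool) + 2) (l.reverse.map letterCode)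

lemma code_append (p s : List (Fin n × Bool)) :
    code (p ++ s) = code s + (Fintype.card (Fin n × Bool) + 2) ^ s.length * code p := by
  rw [code, List.reverse_append, List.map_append, Nat.ofDigits_append]
  simp [code]

lemma code_injective {p q : List (Fin n × Bool)} (hlen : p.length = q.length)
    (h : code p = code q) : p = q := by
  have hlt : ∀ r : List (Fin n × Bool), ∀ x ∈ r.reverse.map letterCode,
      x < Fintype.card (Fin n × Bool) + 2 := by
    intro r x hx
    obtain ⟨L, -, rfl⟩ := List.mem_map.1 hx
    have := (Fintype.equivFin (Fin n × Bool) L).2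
    simp only [letterCode]
    omega
  have h1 := Nat.ofDigits_inj_of_len_eq (by omega) (by simpa using hlen) (hlt p) (hlt q) h
  have hinj : Function.Injective (letterCode (n := n)) := fun a b hab =>
    (Fintype.equivFin (Fin n × Bool)).injective (Fin.ext hab)
  exact List.reverse_injective (List.map_injective_iff.2 hinj h1)

/-- The code of the initial half of a reduced word. -/
def halfCode (g : FreeGroup (Fin n)) : ℕ := code (g.toWord.take (g.norm / 2))

/-- The sum of the codes of the two halves of a reduced word. -/
def halvesCode (g : FreeGroup (Fin n)) : ℕ := halfCode g + halfCode g⁻¹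

lemma halvesCode_inv (g : FreeGroup (Fin n)) : halvesCode g⁻¹ = halvesCode g := by
  rw [halvesCode, halvesCode, inv_inv, add_comm]

/-- Multiplication by `x` replaces the prefix `q` of `y` by the smaller `p`. As `q` is at most half
of `y`, the code of the first half drops and the half seen from the other end is untouched. -/
lemma halvesCode_mul_lt {x y : FreeGroup (Fin n)} {p q z : List (Fin n × Bool)}
    (hx : x.toWord = p ++ FreeGroup.invRev q) (hy : y.toWord = q ++ z) (hpq : p.length = q.length)
    (hz : q.length ≤ z.length) (hnorm : (x * y).norm = y.norm) (hlt : code p < code q) :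
    halvesCode (x * y) < halvesCode y := by
  have hxy : x * y = FreeGroup.mk (p ++ z) := by
    rw [← FreeGroup.mk_toWord (x := x), ← FreeGroup.mk_toWord (x := y), hx, hy, ← FreeGroup.mul_mk,
      ← FreeGroup.mul_mk, ← FreeGroup.mul_mk, ← FreeGroup.inv_mk]
    group
  have hny : y.norm = q.length + z.length := by rw [FreeGroup.norm, hy, List.length_append]
  have hw : (x * y).toWord = p ++ z := by
    rw [hxy]
    apply toWord_of_norm_mk
    rw [← hxy, hnorm, hny, List.length_append, hpq]
  have hmq : q.length ≤ y.norm / 2 := by omega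
  have h1 : halfCode (x * y) < halfCode y := by
    rw [halfCode, halfCode, hw, hnorm, hy, List.take_append, List.take_append,
      List.take_of_length_le (l := p) (by omega), List.take_of_length_le (l := q) (by omega), code_append, code_append,
      hpq]
    have : 0 < (Fintype.card (Fin n × Bool) + 2) ^ (z.take (y.norm / 2 - q.length)).length := by positivity
    have := Nat.mul_lt_mul_of_pos_left hlt this
    omega
  have h2 : halfCode (x * y)⁻¹ = halfCode y⁻¹ := by
    rw [halfCode, halfCode, FreeGroup.norm_inv_eq, FreeGroup.norm_inv_eq, FreeGroup.toWord_inv,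
      FreeGroup.toWord_inv, hw, hnorm, hy, FreeGroup.invRev_append, FreeGroup.invRev_append,
      List.take_append_of_le_length, List.take_append_of_le_length]
    all_goals rw [FreeGroup.invRev_length]; omega
  rw [halvesCode, halvesCode, h2]
  omega

end Code

/-! ### Nielsen reduction and generators of the automorphism group. -/

section NielsenReduced

variable {n : ℕ}

/-- A tuple, with its inverses, that no elementary Nielsen transformation improves. -/
structure IsNielsenMinimal (u : Fin n × Bool → FreeGroup (Fin n)) : Prop where
  ne_one : ∀ L, u L ≠ 1
  flip : ∀ L, u (flipLetter L) = (u L)⁻¹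
  minimal : ∀ L M, L.1 ≠ M.1 → (u M).norm < (u L * u M).norm ∨
    ((u M).norm = (u L * u M).norm ∧ halvesCode (u M) ≤ halvesCode (u L * u M))

namespace IsNielsenMinimal

variable {u : Fin n × Bool → FreeGroup (Fin n)}

lemma two_mul_overlap_le_right (hu : IsNielsenMinimal u) {L M : Fin n × Bool} (h : L.1 ≠ M.1) :
    2 * overlap (u L)⁻¹ (u M) ≤ (u L).norm := by
  have h1 := norm_mul_add (u L) (u M)
  rcases hu.minimal L M h with h2 | h2 <;> omega

/-- Minimality speaks only of distinct generators. With equal generators the hypothesis forces `M =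
L`, where `overlap_inv_self_lt` gives a strict bound. -/
lemma overlap_bounds (hu : IsNielsenMinimal u) {L M : Fin n × Bool} (h : M ≠ flipLetter L) :
    2 * overlap (u L)⁻¹ (u M) ≤ (u L).norm ∧ 2 * overlap (u L)⁻¹ (u M) ≤ (u M).norm ∧
      (L.1 = M.1 → 2 * overlap (u L)⁻¹ (u M) < (u M).norm) := by
  by_cases hf : L.1 = M.1
  · obtain rfl := eq_of_fst_eq_of_ne_flipLetter hf h
    have := overlap_inv_self_lt (hu.ne_one M)
    exact ⟨this.le, this.le, fun _ => this⟩
  · refine ⟨hu.two_mul_overlap_le_right hf, ?_, fun h => absurd h hf⟩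
    have := hu.two_mul_overlap_le_right (L := flipLetter M) (M := flipLetter L) (Ne.symm hf)
    rwa [hu.flip, hu.flip, inv_inv, overlap_comm, FreeGroup.norm_inv_eq] at this

/-- Two adjacent cancellations do not consume a factor. -/
lemma overlap_add_overlap_lt (hu : IsNielsenMinimal u) {L M N : Fin n × Bool} (h : M ≠ flipLetter L)
    (h' : N ≠ flipLetter M) :
    overlap (u L)⁻¹ (u M) + overlap (u M)⁻¹ (u N) < (u M).norm := by
  obtain ⟨-, b2, b3⟩ := hu.overlap_bounds h
  obtain ⟨c1, c2, -⟩ := hu.overlap_bounds h'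
  by_contra! hle
  have e1 : 2 * overlap (u L)⁻¹ (u M) = (u M).norm := by omega
  have e2 : 2 * overlap (u M)⁻¹ (u N) = (u M).norm := by omega
  have hLM : L.1 ≠ M.1 := fun hf => by have := b3 hf; omega
  have hMN : M.1 ≠ N.1 := by
    intro hf
    obtain rfl := eq_of_fst_eq_of_ne_flipLetter hf h'
    have := overlap_inv_self_lt (hu.ne_one N)
    omega
  -- In the bad case both cancellations consume exactly half of `u M`, so `u M = p q⁻¹` with `p`,
  -- `q` of length `k`, where `p` begins `(u L)⁻¹` and `q` begins `u N`.
  set k := overlap (u L)⁻¹ (u M) with hk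
  set p := (u M).toWord.take k with hp
  set q := FreeGroup.invRev ((u M).toWord.drop k) with hq
  have hnM : (u M).norm = (u M).toWord.length := rfl
  have hplen : p.length = k := by rw [hp, List.length_take]; omega
  have hqlen : q.length = k := by rw [hq, FreeGroup.invRev_length, List.length_drop]; omega
  have hM : (u M).toWord = p ++ FreeGroup.invRev q := by
    rw [hq, FreeGroup.invRev_invRev, hp, List.take_append_drop]
  have hM' : (u (flipLetter M)).toWord = q ++ FreeGroup.invRev p := by
    rw [hu.flip, FreeGroup.toWord_inv, hM, FreeGroup.invRev_append, FreeGroup.invRev_invRev]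
  have hL : p <+: (u (flipLetter L)).toWord := by
    refine prefix_of_le_commonPrefix ⟨_, hM.symm⟩ ?_
    rw [commonPrefix_comm, hplen, hu.flip]
    exact hk.le
  have hN : q <+: (u N).toWord := by
    refine prefix_of_le_commonPrefix ⟨_, hM'.symm⟩ ?_
    rw [hqlen, hu.flip]
    change k ≤ overlap (u M)⁻¹ (u N)
    omega
  obtain ⟨y, hy⟩ := hL
  obtain ⟨z, hz⟩ := hN
  have hnN : (u N).norm = q.length + z.length := by rw [FreeGroup.norm, ← hz, List.length_append]
  have hnL : (u (flipLetter L)).norm = p.length + y.length := by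
    rw [FreeGroup.norm, ← hy, List.length_append]
  have hnL' : (u (flipLetter L)).norm = (u L).norm := by rw [hu.flip, FreeGroup.norm_inv_eq]
  have f1 := norm_mul_add (u M) (u N)
  have f2 := norm_mul_add (u (flipLetter M)) (u (flipLetter L))
  have hov : overlap (u (flipLetter M))⁻¹ (u (flipLetter L)) = k := by
    rw [hu.flip, hu.flip, inv_inv, overlap_comm]
  have hnM' : (u (flipLetter M)).norm = (u M).norm := by rw [hu.flip, FreeGroup.norm_inv_eq]
  obtain ⟨b1, -, -⟩ := hu.overlap_bounds h
  -- A smaller `p` improves `u N` through `u M * u N`; a smaller `q` improves `(u L)⁻¹` through `(u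
  -- M)⁻¹ * (u L)⁻¹`; equality makes `u M` trivial.
  rcases lt_trichotomy (code p) (code q) with hc | hc | hc
  · have := halvesCode_mul_lt hM hz.symm (by omega) (by omega) (by omega) hc
    rcases hu.minimal M N hMN with h0 | h0 <;> omega
  · have hpq := code_injective (by omega) hc
    apply hu.ne_one M
    rw [← FreeGroup.mk_toWord (x := u M), hM, hpq, ← FreeGroup.mul_mk,
      ← FreeGroup.inv_mk (L := q), mul_inv_cancel]
  · have := halvesCode_mul_lt hM' hy.symm (by omega) (by omega) (by omega) hc
    rcases hu.minimal (flipLetter M) (flipLetter L) (Ne.symm hLM) with h0 | h0 <;> omega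

/-- Part of every factor survives both adjacent cancellations, so the product still begins like its
first factor beyond the overlap with `(u K)⁻¹`. Each factor therefore contributes at least one
letter to the length; carrying the overlap in the bound makes the induction close. -/
lemma overlap_prod (hu : IsNielsenMinimal u) {L : Fin n × Bool} {w : List (Fin n × Bool)}
    (hw : (L :: w).IsChain fun a b => b ≠ flipLetter a) {K : Fin n × Bool} (hK : L ≠ flipLetter K) :
    overlap (u K)⁻¹ ((L :: w).map u).prod = overlap (u K)⁻¹ (u L) ∧
      overlap (u K)⁻¹ (u L) + (L :: w).length ≤ ((L :: w).map u).prod.norm := by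
  induction w generalizing L K with
  | nil =>
    have := hu.overlap_bounds hK
    have h1 : (u L).norm ≠ 0 := fun h => hu.ne_one L (FreeGroup.norm_eq_zero.1 h)
    simp only [List.map_cons, List.map_nil, List.prod_cons, List.prod_nil, mul_one, true_and,
      List.length_singleton]
    omega
  | cons M w ih =>
    obtain ⟨hLM, hw'⟩ := List.isChain_cons_cons.1 hw
    obtain ⟨i1, i2⟩ := ih hw' hLM
    have hlt := hu.overlap_add_overlap_lt hK hLM
    rw [List.map_cons, List.prod_cons]
    set v := ((M :: w).map u).prod with hv
    have f1 := norm_mul_add (u L) v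
    rw [i1] at f1
    have f2 := norm_inv_mul_add (u L * v) (u L)
    have f3 : ((u L * v)⁻¹ * u L).norm = v.norm := by
      rw [mul_inv_rev, mul_assoc, inv_mul_cancel, mul_one, FreeGroup.norm_inv_eq]
    -- By `f1`, `f2` and `f3`, `u L * v` agrees with `u L` longer than `(u K)⁻¹` does; the
    -- ultrametric inequality in both directions then equates the two overlaps with `(u K)⁻¹`.
    have g1 := min_overlap_le (u K)⁻¹ (u L) (u L * v)
    have g2 := min_overlap_le (u K)⁻¹ (u L * v) (u L)
    rw [overlap_comm (u L)] at g1
    simp only [List.length_cons] at i2 ⊢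
    omega

end IsNielsenMinimal

/-- The endomorphism multiplying the letter `M` by `g` on the left. -/
def transvectionHom (g : FreeGroup (Fin n)) (M : Fin n × Bool) :
    FreeGroup (Fin n) →* FreeGroup (Fin n) :=
  FreeGroup.lift fun k =>
    if k = M.1 then (if M.2 then g * FreeGroup.of k else FreeGroup.of k * g⁻¹) else FreeGroup.of k

lemma transvectionHom_letter (g : FreeGroup (Fin n)) (M : Fin n × Bool) :
    transvectionHom g M (letter M) = g * letter M := by
  obtain ⟨i, b⟩ := M
  cases b
  · simp [letter_false, transvectionHom]
  · simp [letter_true, transvectionHom]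

lemma transvectionHom_of_ne (g : FreeGroup (Fin n)) {M : Fin n × Bool} {k : Fin n} (h : k ≠ M.1) :
    transvectionHom g M (FreeGroup.of k) = FreeGroup.of k := by
  simp [transvectionHom, h]

lemma transvectionHom_letter_of_ne (g : FreeGroup (Fin n)) {M L : Fin n × Bool} (h : L.1 ≠ M.1) :
    transvectionHom g M (letter L) = letter L := by
  obtain ⟨i, b⟩ := L
  cases b
  · rw [letter_false, map_inv, transvectionHom_of_ne g h]
  · rw [letter_true, transvectionHom_of_ne g h]

lemma transvectionHom_comp {L M : Fin n × Bool} (h : L.1 ≠ M.1) :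
    (transvectionHom (letter L) M).comp (transvectionHom (letter L)⁻¹ M) = MonoidHom.id _ := by
  have key : ∀ k, ((transvectionHom (letter L) M).comp (transvectionHom (letter L)⁻¹ M))
      (FreeGroup.of k) = FreeGroup.of k := by
    intro k
    rw [MonoidHom.comp_apply]
    by_cases hk : k = M.1
    · subst hk
      have h1 : (transvectionHom (letter L) M) ((transvectionHom (letter L)⁻¹ M) (letter M))
          = letter M := by
        rw [transvectionHom_letter, map_mul, map_inv, transvectionHom_letter,
          transvectionHom_letter_of_ne _ h, inv_mul_cancel_left]
      obtain ⟨i, b⟩ := M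
      cases b
      · rw [letter_false, map_inv, map_inv] at h1
        exact inv_injective h1
      · exact h1
    · rw [transvectionHom_of_ne _ hk, transvectionHom_of_ne _ hk]
  exact FreeGroup.ext_hom _ _ (by simpa using key)

/-- The elementary Nielsen automorphism multiplying the letter `M` by the letter `L` on the left. -/
def transvection (L M : Fin n × Bool) (h : L.1 ≠ M.1) : MulAut (FreeGroup (Fin n)) :=
  MonoidHom.toMulEquiv (transvectionHom (letter L) M) (transvectionHom (letter L)⁻¹ M)
    (by
      have := transvectionHom_comp (L := flipLetter L) (M := M) h
      rwa [letter_flipLetter, inv_inv] at this)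
    (transvectionHom_comp h)

lemma transvection_letter {L M : Fin n × Bool} (h : L.1 ≠ M.1) :
    transvection L M h (letter M) = letter L * letter M := transvectionHom_letter _ _

lemma transvection_of_ne {L M : Fin n × Bool} (h : L.1 ≠ M.1) {k : Fin n} (hk : k ≠ M.1) :
    transvection L M h (FreeGroup.of k) = FreeGroup.of k := transvectionHom_of_ne _ hk

/-- The complexity of a basis of a free group. -/
def complexity (β : MulAut (FreeGroup (Fin n))) : ℕ ×ₗ ℕ :=
  toLex (∑ i, (β (FreeGroup.of i)).norm, ∑ i, halvesCode (β (FreeGroup.of i)))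

lemma norm_letter (β : MulAut (FreeGroup (Fin n))) (M : Fin n × Bool) :
    (β (letter M)).norm = (β (FreeGroup.of M.1)).norm := by
  obtain ⟨i, b⟩ := M
  cases b
  · rw [letter_false, map_inv, FreeGroup.norm_inv_eq]
  · rfl

lemma halvesCode_letter (β : MulAut (FreeGroup (Fin n))) (M : Fin n × Bool) :
    halvesCode (β (letter M)) = halvesCode (β (FreeGroup.of M.1)) := by
  obtain ⟨i, b⟩ := M
  cases b
  · rw [letter_false, map_inv, halvesCode_inv]
  · rfl

/-- A transvection changes a single basis element, so comparing the total complexities amounts to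
comparing that one summand. -/
lemma isNielsenMinimal_of_complexity_le {β : MulAut (FreeGroup (Fin n))}
    (h : ∀ (L M : Fin n × Bool) (hLM : L.1 ≠ M.1), complexity β ≤ complexity (β * transvection L M hLM)) :
    IsNielsenMinimal fun L => β (letter L) := by
  refine ⟨fun L hL => ?_, fun L => by rw [letter_flipLetter, map_inv], fun L M hLM => ?_⟩
  · rw [map_eq_one_iff β β.injective] at hL
    have := congrArg FreeGroup.norm hL
    have h2 := norm_letter 1 L
    rw [MulAut.one_apply, MulAut.one_apply, FreeGroup.norm_of] at h2
    rw [h2] at this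
    simp at this
  · have h1 := h L M hLM
    set γ := β * transvection L M hLM with hγ
    have hother : ∀ k ≠ M.1, γ (FreeGroup.of k) = β (FreeGroup.of k) := fun k hk => by
      rw [hγ, MulAut.mul_apply, transvection_of_ne hLM hk]
    have hM : γ (letter M) = β (letter L) * β (letter M) := by
      rw [hγ, MulAut.mul_apply, transvection_letter hLM, map_mul]
    rw [complexity, complexity, Prod.Lex.toLex_le_toLex] at h1
    have hs : ∀ f : FreeGroup (Fin n) → ℕ, ∑ i, f (β (FreeGroup.of i)) + f (γ (FreeGroup.of M.1))
        = ∑ i, f (γ (FreeGroup.of i)) + f (β (FreeGroup.of M.1)) := by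
      intro f
      rw [← Finset.add_sum_erase _ _ (Finset.mem_univ M.1),
        ← Finset.add_sum_erase _ (fun i => f (γ (FreeGroup.of i))) (Finset.mem_univ M.1)]
      have : ∑ k ∈ Finset.univ.erase M.1, f (β (FreeGroup.of k))
          = ∑ k ∈ Finset.univ.erase M.1, f (γ (FreeGroup.of k)) :=
        Finset.sum_congr rfl (fun k hk => by rw [hother k (Finset.ne_of_mem_erase hk)])
      rw [this]
      ring
    have s1 := hs FreeGroup.norm
    have s2 := hs halvesCode
    rw [← hM, norm_letter, norm_letter, halvesCode_letter, halvesCode_letter]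
    simp only at h1
    omega

/-- An automorphism all of whose transvections are at least as complex permutes the letters. -/
lemma exists_letter_of_isNielsenMinimal {β : MulAut (FreeGroup (Fin n))}
    (h : IsNielsenMinimal fun L => β (letter L)) (j : Fin n) :
    ∃ L, β⁻¹ (FreeGroup.of j) = letter L := by
  set w := (β⁻¹ (FreeGroup.of j)).toWord with hw
  have hprod : ∀ l : List (Fin n × Bool), (l.map fun L => β (letter L)).prod
      = β (FreeGroup.mk l) := by
    intro l
    induction l with
    | nil => exact (map_one β).symm
    | cons a l ih => rw [List.map_cons, List.prod_cons, ih, ← map_mul, letter, FreeGroup.mul_mk]; rfl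
  have hred : w.IsChain fun a b => b ≠ flipLetter a := by
    have : FreeGroup.IsReduced w := FreeGroup.isReduced_toWord
    refine List.IsChain.imp (fun a b hab => ?_) this
    rintro rfl
    simpa [flipLetter] using hab rfl
  have hβ : β (FreeGroup.mk w) = FreeGroup.of j := by
    rw [hw, FreeGroup.mk_toWord, MulAut.apply_inv_self]
  have hmk : β⁻¹ (FreeGroup.of j) = FreeGroup.mk w := by rw [hw, FreeGroup.mk_toWord]
  match w, hred, hβ, hmk with
  | [], hred, hβ, hmk =>
    exact absurd (hβ.symm.trans (map_one β)) (FreeGroup.of_ne_one j)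
  | [L], hred, hβ, hmk => exact ⟨L, hmk⟩
  | L :: M :: l, hred, hβ, hmk =>
    -- A reduced word in the new basis is at most as long as its image, and the image here is a
    -- single generator; any admissible `K` would serve.
    have := (h.overlap_prod hred (K := L) (by
      intro h0; simpa [flipLetter] using congrArg Prod.snd h0)).2
    rw [hprod, hβ, FreeGroup.norm_of] at this
    simp only [List.length_cons] at this
    omega

/-- Nielsen's theorem: the automorphisms permuting the letters and the transvections generate the
automorphism group of a free group of finite rank. -/
theorem subgroup_eq_top_of_nielsen (H : Subgroup (MulAut (FreeGroup (Fin n))))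
    (hperm : ∀ γ : MulAut (FreeGroup (Fin n)), (∀ j, ∃ L, γ (FreeGroup.of j) = letter L) → γ ∈ H)
    (htrans : ∀ L M (h : L.1 ≠ M.1), transvection L M h ∈ H) : H = ⊤ := by
  rw [Subgroup.eq_top_iff']
  intro α
  obtain ⟨β, ⟨ν, hν, hβ⟩, hmin⟩ : ∃ β, (∃ ν ∈ H, β = α * ν) ∧
      ∀ γ, (∃ ν ∈ H, γ = α * ν) → complexity β ≤ complexity γ := by
    obtain ⟨β, hβ, hmin⟩ := (wellFounded_lt (α := ℕ ×ₗ ℕ)).onFun (f := complexity).has_min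
      {β | ∃ ν ∈ H, β = α * ν} ⟨α, 1, H.one_mem, (mul_one α).symm⟩
    exact ⟨β, hβ, fun γ hγ => not_lt.1 (hmin γ hγ)⟩
  have h1 : IsNielsenMinimal fun L => β (letter L) :=
    isNielsenMinimal_of_complexity_le fun L M hLM =>
      hmin _ ⟨ν * transvection L M hLM, H.mul_mem hν (htrans L M hLM), by rw [hβ, mul_assoc]⟩
  have h2 : β⁻¹ ∈ H := hperm _ (exists_letter_of_isNielsenMinimal h1)
  have h3 : α = β * ν⁻¹ := by rw [hβ, mul_inv_cancel_right]
  rw [h3]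
  exact H.mul_mem (H.inv_mem_iff.1 h2) (H.inv_mem hν)

end NielsenReduced
end
end FrickeCharacters

namespace FrickeCharacters

noncomputable section

open MvPolynomial

/-! ### The generic representation and its parameters. -/

section Generic

variable {n : ℕ}

/-- The upper unitriangular matrix. -/
def upperUnip {A : Type} [CommRing A] (x : A) : Matrix.SpecialLinearGroup (Fin 2) A :=
  ⟨!![1, x; 0, 1], by simp⟩

/-- The lower unitriangular matrix. -/
def lowerUnip {A : Type} [CommRing A] (x : A) : Matrix.SpecialLinearGroup (Fin 2) A :=
  ⟨!![1, 0; x, 1], by simp⟩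

/-- A product of four unitriangular matrices. -/
def unipProd {A : Type} [CommRing A] (x : Fin 4 → A) : Matrix.SpecialLinearGroup (Fin 2) A :=
  upperUnip (x 0) * lowerUnip (x 1) * upperUnip (x 2) * lowerUnip (x 3)

lemma unipProd_val {A : Type} [CommRing A] (x y z w : A) :
    (unipProd ![x, y, z, w]).1
      = !![1, x; 0, 1] * !![1, 0; y, 1] * !![1, z; 0, 1] * !![1, 0; w, 1] := rfl

lemma map_upperUnip {A B : Type} [CommRing A] [CommRing B] (f : A →+* B) (x : A) :
    Matrix.SpecialLinearGroup.map f (upperUnip x) = upperUnip (f x) := by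
  apply Subtype.ext
  change (!![1, x; 0, 1] : Matrix (Fin 2) (Fin 2) A).map f = !![1, f x; 0, 1]
  ext i j
  fin_cases i <;> fin_cases j <;> simp

lemma map_lowerUnip {A B : Type} [CommRing A] [CommRing B] (f : A →+* B) (x : A) :
    Matrix.SpecialLinearGroup.map f (lowerUnip x) = lowerUnip (f x) := by
  apply Subtype.ext
  change (!![1, 0; x, 1] : Matrix (Fin 2) (Fin 2) A).map f = !![1, 0; f x, 1]
  ext i j
  fin_cases i <;> fin_cases j <;> simp

lemma map_unipProd {A B : Type} [CommRing A] [CommRing B] (f : A →+* B) (x : Fin 4 → A) :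
    Matrix.SpecialLinearGroup.map f (unipProd x) = unipProd (f ∘ x) := by
  simp only [unipProd, map_mul, map_upperUnip, map_lowerUnip, Function.comp_apply]

/-- The last factor alters the lower left entry to a nonzero `c`; a determinant-one matrix with `c ≠
0` is then upper, lower, upper unitriangular. -/
lemma fin_two_eq_unip_mul {k : Type} [Field k] {a b c d s : k} (hc : c ≠ 0)
    (h : a * d - b * (c - d * s) = 1) : !![a, b; c - d * s, d]
      = !![1, (a + b * s - 1) / c; 0, 1] * !![1, 0; c, 1] * !![1, (d - 1) / c; 0, 1]
        * !![1, 0; -s, 1] := by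
  simp only [Matrix.mul_fin_two]
  ext i j
  fin_cases i <;> fin_cases j <;> simp <;> field_simp
  · linear_combination s * h
  · linear_combination -h
  · ring
  · ring

lemma exists_unipProd {k : Type} [Field k] (M : Matrix.SpecialLinearGroup (Fin 2) k) :
    ∃ x, M = unipProd x := by
  have hdet := M.2
  rw [Matrix.det_fin_two] at hdet
  have key : ∀ s : k, M.1 1 0 + M.1 1 1 * s ≠ 0 → ∃ x, M = unipProd x := by
    intro s hs
    refine ⟨![(M.1 0 0 + M.1 0 1 * s - 1) / (M.1 1 0 + M.1 1 1 * s), M.1 1 0 + M.1 1 1 * s,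
      (M.1 1 1 - 1) / (M.1 1 0 + M.1 1 1 * s), -s], ?_⟩
    apply Subtype.ext
    rw [unipProd_val, ← fin_two_eq_unip_mul hs (by linear_combination hdet)]
    conv_lhs => rw [Matrix.eta_fin_two M.1]
    rw [add_sub_cancel_right]
  -- The bottom row is nonzero, so one of `s = 0`, `s = 1` makes the pivot nonzero.
  by_cases h : M.1 1 0 = 0
  · refine key 1 ?_
    intro h0
    rw [h] at hdet h0
    have : M.1 1 1 = 0 := by linear_combination h0
    rw [this] at hdet
    simp at hdet
  · exact key 0 (by simpa using h)

/-- The coordinate ring of the parameter space of representations. -/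
abbrev GenericRing (n : ℕ) : Type := MvPolynomial (Fin n × Fin 4) ℤ

/-- The generic representation of the free group in `SL₂`. -/
def genericRep (n : ℕ) : FreeGroup (Fin n) →* Matrix.SpecialLinearGroup (Fin 2) (GenericRing n) :=
  FreeGroup.lift fun i => unipProd fun k => X (i, k)

/-- The representation with given parameters. -/
def specialRep {B : Type} [CommRing B] (y : Fin n × Fin 4 → B) :
    FreeGroup (Fin n) →* Matrix.SpecialLinearGroup (Fin 2) B :=
  (Matrix.SpecialLinearGroup.map (aeval y : GenericRing n →ₐ[ℤ] B).toRingHom).comp (genericRep n)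

lemma tr_specialRep {B : Type} [CommRing B] (y : Fin n × Fin 4 → B) (w : FreeGroup (Fin n)) :
    tr (specialRep y) w = aeval y (tr (genericRep n) w) := by
  rw [tr, tr, Matrix.trace_fin_two, Matrix.trace_fin_two, map_add]
  rfl

lemma exists_specialRep {k : Type} [Field k]
    (ρ : FreeGroup (Fin n) →* Matrix.SpecialLinearGroup (Fin 2) k) : ∃ y, ρ = specialRep y := by
  choose x hx using fun i => exists_unipProd (ρ (FreeGroup.of i))
  refine ⟨fun p => x p.1 p.2, FreeGroup.ext_hom _ _ fun i => ?_⟩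
  rw [specialRep, MonoidHom.comp_apply, genericRep, FreeGroup.lift_apply_of, map_unipProd, hx]
  congr 1
  funext k
  simp

/-- The substitution of the generic traces of the basic words. -/
def traceEval (n : ℕ) : MvPolynomial (BasicIndex n) ℤ →ₐ[ℤ] GenericRing n :=
  aeval fun T => tr (genericRep n) (basicWord T)

lemma aeval_tr_specialRep {B : Type} [CommRing B] (y : Fin n × Fin 4 → B)
    (p : MvPolynomial (BasicIndex n) ℤ) :
    aeval (fun T => tr (specialRep y) (basicWord T)) p = aeval y (traceEval n p) := by
  rw [← AlgHom.comp_apply]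
  congr 1
  ext T
  simp [traceEval, tr_specialRep]

lemma exists_traceEval_eq (w : FreeGroup (Fin n)) : ∃ p, traceEval n p = tr (genericRep n) w := by
  have h := tr_mk_mem (genericRep n) (T := Finset.univ) w.toWord (fun x _ => Finset.mem_univ _)
  rw [FreeGroup.mk_toWord] at h
  have hle : traceAlg (genericRep n) Finset.univ ≤ (traceEval n).range := by
    refine Algebra.adjoin_le ?_
    rintro _ ⟨U, hU, -, rfl⟩
    exact ⟨X ⟨U, hU⟩, by simp [traceEval]; rfl⟩
  exact hle h

lemma exists_traceEval_eq_of_mem_lowerAlg {T : Finset (Fin n)} {a : GenericRing n}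
    (ha : a ∈ lowerAlg (genericRep n) T) :
    ∃ p ∈ Algebra.adjoin ℤ {q : MvPolynomial (BasicIndex n) ℤ | ∃ U : BasicIndex n, U.1 ⊂ T ∧ q = X U},
      traceEval n p = a := by
  have hle : lowerAlg (genericRep n) T ≤ (Algebra.adjoin ℤ
      {q : MvPolynomial (BasicIndex n) ℤ | ∃ U : BasicIndex n, U.1 ⊂ T ∧ q = X U}).map
        (traceEval n) := by
    refine Algebra.adjoin_le ?_
    rintro _ ⟨U, hU, hUT, rfl⟩
    exact ⟨X ⟨U, hU⟩, Algebra.subset_adjoin ⟨⟨U, hU⟩, hUT, rfl⟩, by simp [traceEval]; rfl⟩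
  exact hle ha

end Generic

/-! ### Lifting automorphisms to integral polynomial automorphisms. -/

section Liftable

variable {n : ℕ}

/-- An automorphism of the free group is liftable if its action on characters extends to an integral
polynomial automorphism of affine space. -/
def IsLiftable (α : MulAut (FreeGroup (Fin n))) : Prop :=
  ∃ φ : MvPolynomial (BasicIndex n) ℤ ≃ₐ[ℤ] MvPolynomial (BasicIndex n) ℤ,
    ∀ (ρ : FreeGroup (Fin n) →* Matrix.SpecialLinearGroup (Fin 2) ℂ) (T : BasicIndex n),
      aeval (fun U => tr ρ (basicWord U)) (φ (X T)) = tr ρ (α (basicWord T))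

/-- Passing from variables to all polynomials shows that `φ` realizes precomposition with `α`, which
is what makes lifts compose and invert. -/
lemma IsLiftable.aeval_apply {α : MulAut (FreeGroup (Fin n))}
    {φ : MvPolynomial (BasicIndex n) ℤ ≃ₐ[ℤ] MvPolynomial (BasicIndex n) ℤ}
    (h : ∀ (ρ : FreeGroup (Fin n) →* Matrix.SpecialLinearGroup (Fin 2) ℂ) (T : BasicIndex n),
      aeval (fun U => tr ρ (basicWord U)) (φ (X T)) = tr ρ (α (basicWord T)))
    (ρ : FreeGroup (Fin n) →* Matrix.SpecialLinearGroup (Fin 2) ℂ)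
    (p : MvPolynomial (BasicIndex n) ℤ) :
    aeval (fun U => tr ρ (basicWord U)) (φ p)
      = aeval (fun U => tr (ρ.comp α.toMonoidHom) (basicWord U)) p := by
  have : (aeval (fun U => tr ρ (basicWord U))).comp (φ : _ →ₐ[ℤ] MvPolynomial (BasicIndex n) ℤ)
      = aeval (fun U => tr (ρ.comp α.toMonoidHom) (basicWord U)) := by
    ext T
    simp only [AlgHom.comp_apply, aeval_X]
    exact h ρ T
  exact congrArg (fun f => f p) this

/-- The group of liftable automorphisms. -/
def liftableSubgroup (n : ℕ) : Subgroup (MulAut (FreeGroup (Fin n))) where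
  carrier := {α | IsLiftable α}
  one_mem' := ⟨AlgEquiv.refl, fun ρ T => by simp⟩
  mul_mem' := by
    rintro α β ⟨φ, hφ⟩ ⟨ψ, hψ⟩
    refine ⟨ψ.trans φ, fun ρ T => ?_⟩
    rw [AlgEquiv.trans_apply, IsLiftable.aeval_apply hφ, hψ]
    rfl
  inv_mem' := by
    rintro α ⟨φ, hφ⟩
    refine ⟨φ.symm, fun ρ T => ?_⟩
    have h := IsLiftable.aeval_apply hφ (ρ.comp (α⁻¹).toMonoidHom) (φ.symm (X T))
    rw [AlgEquiv.apply_symm_apply, aeval_X] at h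
    have h2 : (ρ.comp (α⁻¹).toMonoidHom).comp α.toMonoidHom = ρ := by
      ext1 i
      change ρ (α⁻¹ (α _)) = _
      rw [MulAut.inv_apply_self]
    rw [h2] at h
    rw [← h]
    rfl

/-- The kernels of the iterates stabilize, and any element of `ker f` is an `f ^ k`-image of an
element of the next kernel. -/
lemma injective_of_surjective_of_isNoetherianRing {R : Type} [CommRing R] [IsNoetherianRing R]
    (f : R →+* R) (hf : Function.Surjective f) : Function.Injective f := by
  let K : ℕ →o Ideal R :=
    { toFun := fun k => RingHom.ker (f ^ k)
      monotone' := monotone_nat_of_le_succ fun k x hx => by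
        rw [RingHom.mem_ker] at hx ⊢
        rw [pow_succ', RingHom.mul_def, RingHom.comp_apply, hx, map_zero] }
  obtain ⟨k, hk⟩ := monotone_stabilizes_iff_noetherian.2 (inferInstanceAs (IsNoetherian R R)) K
  rw [injective_iff_map_eq_zero]
  intro x hx
  obtain ⟨y, rfl⟩ : ∃ y, (f ^ k) y = x := by
    rw [RingHom.coe_pow]
    exact hf.iterate k x
  have h1 : y ∈ K (k + 1) := by
    change (f ^ (k + 1)) y = 0
    rw [pow_succ', RingHom.mul_def, RingHom.comp_apply, hx]
  rw [← hk (k + 1) k.le_succ] at h1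
  exact h1

lemma isLiftable_of_surjective {α : MulAut (FreeGroup (Fin n))}
    (φ : MvPolynomial (BasicIndex n) ℤ →ₐ[ℤ] MvPolynomial (BasicIndex n) ℤ)
    (hsurj : Function.Surjective φ)
    (h : ∀ T, traceEval n (φ (X T)) = tr (genericRep n) (α (basicWord T))) : IsLiftable α := by
  have hinj : Function.Injective φ :=
    injective_of_surjective_of_isNoetherianRing φ.toRingHom hsurj
  refine ⟨AlgEquiv.ofBijective φ ⟨hinj, hsurj⟩, fun ρ T => ?_⟩
  obtain ⟨y, rfl⟩ := exists_specialRep ρ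
  change aeval _ (φ (X T)) = _
  rw [aeval_tr_specialRep, h, tr_specialRep]

lemma surjective_of_forall_X_mem {σ : Type} (φ : MvPolynomial σ ℤ →ₐ[ℤ] MvPolynomial σ ℤ)
    (h : ∀ i, X i ∈ φ.range) : Function.Surjective φ := by
  rw [← AlgHom.range_eq_top, ← top_le_iff, ← MvPolynomial.adjoin_range_X]
  exact Algebra.adjoin_le (by rintro _ ⟨i, rfl⟩; exact h i)

lemma map_sortedWord {γ : MulAut (FreeGroup (Fin n))} {L : Fin n → Fin n × Bool}
    (h : ∀ j, γ (FreeGroup.of j) = letter (L j)) (T : Finset (Fin n)) :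
    γ (sortedWord T) = FreeGroup.mk ((T.sort (· ≤ ·)).map L) := by
  rw [sortedWord]
  induction T.sort (· ≤ ·) with
  | nil => exact map_one γ
  | cons a l ih =>
    rw [List.map_cons, List.prod_cons, map_mul, ih, h, letter, FreeGroup.mul_mk]
    rfl

lemma letter_injective {n : ℕ} : Function.Injective (letter (n := n)) := by
  intro L M h
  have := congrArg FreeGroup.toWord h
  rw [letter, letter, FreeGroup.toWord_mk, FreeGroup.toWord_mk, FreeGroup.reduce_singleton,
    FreeGroup.reduce_singleton] at this
  exact List.singleton_inj.1 this

/-- Automorphisms permuting the letters are liftable. -/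
lemma isLiftable_of_letters (γ : MulAut (FreeGroup (Fin n)))
    (h : ∀ j, ∃ L, γ (FreeGroup.of j) = letter L) : IsLiftable γ := by
  choose L hL using h
  have hinj : Function.Injective fun j => (L j).1 := by
    intro i j hij
    by_cases hs : (L i).2 = (L j).2
    · have : L i = L j := Prod.ext hij hs
      exact FreeGroup.of_injective (γ.injective (by rw [hL, hL, this]))
    · have : L i = flipLetter (L j) := Prod.ext hij (by simpa [flipLetter, ← Bool.eq_not] using hs)
      have h1 : γ (FreeGroup.of i) = γ (FreeGroup.of j)⁻¹ := by
        rw [map_inv, hL, hL, this, letter_flipLetter]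
      have h2 := letter_injective (a₁ := (i, true)) (a₂ := (j, false)) (by
        rw [letter_true, letter_false]; exact γ.injective h1)
      exact (Prod.mk.inj h2).1
  have hbij := Finite.injective_iff_bijective.1 hinj
  let img : BasicIndex n → BasicIndex n := fun T => ⟨T.1.image fun j => (L j).1, T.2.image _⟩
  -- The lift is chosen triangular: `± X (img T)` plus a polynomial in variables indexed by smaller
  -- sets. Its surjectivity then follows by induction on cardinality.
  have hex : ∀ T : BasicIndex n, ∃ p : MvPolynomial (BasicIndex n) ℤ,
      (p - X (img T) ∈ Algebra.adjoin ℤ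
        {q : MvPolynomial (BasicIndex n) ℤ | ∃ U : BasicIndex n, U.1 ⊂ (img T).1 ∧ q = X U} ∨
       p + X (img T) ∈ Algebra.adjoin ℤ
        {q : MvPolynomial (BasicIndex n) ℤ | ∃ U : BasicIndex n, U.1 ⊂ (img T).1 ∧ q = X U}) ∧
      traceEval n p = tr (genericRep n) (γ (basicWord T)) := by
    intro T
    have hw : γ (basicWord T) = FreeGroup.mk ((T.1.sort (· ≤ ·)).map L) := map_sortedWord hL T.1
    have hs : support ((T.1.sort (· ≤ ·)).map L) = (img T).1 := by
      ext x
      simp [support, img]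
    have hX : traceEval n (X (img T)) = tr (genericRep n) (sortedWord (img T).1) := by
      simp [traceEval]; rfl
    have := eqUpToSign_sortedWord (genericRep n) ((T.1.sort (· ≤ ·)).map L) (by
      rw [List.map_map]
      exact (Finset.sort_nodup _ _).map hinj)
    rw [hs, ← hw, ← hX] at this
    rcases this with h | h
    · obtain ⟨p, hp, hpe⟩ := exists_traceEval_eq_of_mem_lowerAlg h
      exact ⟨p + X (img T), Or.inl (by simpa using hp), by rw [map_add, hpe]; ring⟩
    · obtain ⟨p, hp, hpe⟩ := exists_traceEval_eq_of_mem_lowerAlg h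
      exact ⟨p - X (img T), Or.inr (by simpa using hp), by rw [map_sub, hpe]; ring⟩
  choose P hP hPe using hex
  refine isLiftable_of_surjective (aeval P) (surjective_of_forall_X_mem _ ?_) fun T => by
    rw [aeval_X, hPe]
  have key : ∀ (k : ℕ) (U : BasicIndex n), U.1.card = k →
      X U ∈ (aeval P : MvPolynomial (BasicIndex n) ℤ →ₐ[ℤ] MvPolynomial (BasicIndex n) ℤ).range := by
    intro k
    induction k using Nat.strong_induction_on with
    | _ k ih =>
      intro U hU
      have hT : ∃ T, img T = U := by
        refine ⟨⟨Finset.univ.filter fun j => (L j).1 ∈ U.1, ?_⟩, ?_⟩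
        · obtain ⟨x, hx⟩ := U.2
          obtain ⟨j, hj⟩ := hbij.2 x
          exact ⟨j, by simpa [hj] using hx⟩
        · apply Subtype.ext
          ext x
          obtain ⟨j, rfl⟩ := hbij.2 x
          simp only [img, Finset.mem_image, Finset.mem_filter, Finset.mem_univ, true_and]
          exact ⟨fun ⟨i, hi, hij⟩ => hij ▸ hi, fun hj => ⟨j, hj, rfl⟩⟩
      obtain ⟨T, rfl⟩ := hT
      have hle : Algebra.adjoin ℤ {q : MvPolynomial (BasicIndex n) ℤ |
          ∃ U : BasicIndex n, U.1 ⊂ (img T).1 ∧ q = X U} ≤ (aeval P).range := by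
        refine Algebra.adjoin_le ?_
        rintro _ ⟨V, hV, rfl⟩
        exact ih _ (hU ▸ Finset.card_lt_card hV) V rfl
      have hPT : P T ∈ (aeval P : MvPolynomial (BasicIndex n) ℤ →ₐ[ℤ] _).range := ⟨X T, by simp⟩
      rcases hP T with h | h
      · have := sub_mem hPT (hle h)
        rwa [sub_sub_cancel] at this
      · have := sub_mem (hle h) hPT
        rwa [add_sub_cancel_left] at this
  exact fun U => key _ U rfl

/-- The first generator is multiplied by the second one. -/
lemma isLiftable_transvection_first {a b : Fin n} (hab : a < b) (hall : ∀ c, c = a ∨ b ≤ c) :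
    IsLiftable (transvection (b, false) (a, false) hab.ne') := by
  set t := transvection (b, false) (a, false) hab.ne' with ht
  have hta : t (FreeGroup.of a) = FreeGroup.of a * FreeGroup.of b := by
    have := transvection_letter (L := (b, false)) (M := (a, false)) hab.ne'
    rw [letter_false, letter_false, map_inv] at this
    rw [← inv_inj, this, mul_inv_rev]
  have htc : ∀ c ≠ a, t (FreeGroup.of c) = FreeGroup.of c := fun c hc =>
    transvection_of_ne (M := (a, false)) hab.ne' hc
  have htw : ∀ T : Finset (Fin n), a ∉ T → t (sortedWord T) = sortedWord T := by
    intro T hT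
    induction T using Finset.induction_on_min with
    | empty => rw [sortedWord_empty, map_one]
    | insert c s hc ih =>
      rw [sortedWord_insert hc, map_mul, htc c (fun h => hT (by simp [h])),
        ih (fun h => hT (by simp [h]))]
  have hamin : ∀ T : Finset (Fin n), a ∉ T → ∀ x ∈ T, a < x := fun T hT x hx =>
    (hall x).elim (fun h => absurd (h ▸ hx) hT) (fun h => hab.trans_le h)
  have hbmin : ∀ T : Finset (Fin n), a ∉ T → b ∉ T → ∀ x ∈ T, b < x := fun T hT hT' x hx =>
    (hall x).elim (fun h => absurd (h ▸ hx) hT)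
      (fun h => lt_of_le_of_ne h (fun h' => hT' (h' ▸ hx)))
  let B : BasicIndex n := ⟨{b}, by simp⟩
  let ins : BasicIndex n → BasicIndex n := fun T => ⟨insert b T.1, by simp⟩
  -- Only sets containing `a` are ever used; for them deleting `b` leaves a nonempty set.
  let del : BasicIndex n → BasicIndex n := fun T => if h : a ∈ T.1 then
    ⟨T.1.erase b, ⟨a, by simp [hab.ne, h]⟩⟩ else T
  -- The word `aY` goes to the basic word `abY`, while `abY` goes to `ab²Y`, whose trace is `tr b ·
  -- tr (abY) - tr (aY)`. Words without `a` are fixed.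
  let P : BasicIndex n → MvPolynomial (BasicIndex n) ℤ := fun T =>
    if a ∈ T.1 then if b ∈ T.1 then X B * X T - X (del T) else X (ins T) else X T
  have hX : ∀ U : BasicIndex n, traceEval n (X U) = tr (genericRep n) (sortedWord U.1) := fun U => by
    simp [traceEval]; rfl
  have hbw : ∀ U : BasicIndex n, basicWord U = sortedWord U.1 := fun U => rfl
  refine isLiftable_of_surjective (aeval P) (surjective_of_forall_X_mem _ ?_) fun T => ?_
  · have hmem : ∀ T, P T ∈ (aeval P : MvPolynomial (BasicIndex n) ℤ →ₐ[ℤ] _).range := fun T =>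
      ⟨X T, by simp⟩
    have h0 : ∀ T : BasicIndex n, a ∉ T.1 → X T ∈ (aeval P).range := fun T hT => by
      have := hmem T
      simpa only [P, hT, if_false] using this
    have h1 : ∀ T : BasicIndex n, a ∈ T.1 → b ∈ T.1 → X T ∈ (aeval P).range := fun T hT hT' => by
      have := hmem (del T)
      have ha : a ∈ (del T).1 := by simp [del, hT, hab.ne]
      have hb : b ∉ (del T).1 := by simp [del, hT]
      have hTT : ins (del T) = T := by
        apply Subtype.ext
        simp [ins, del, hT, Finset.insert_erase hT']
      simpa only [P, ha, hb, if_true, if_false, hTT] using this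
    intro T
    by_cases ha : a ∈ T.1
    · by_cases hb : b ∈ T.1
      · exact h1 T ha hb
      · have ha' : a ∈ (ins T).1 := by simp [ins, ha]
        have hb' : b ∈ (ins T).1 := by simp [ins]
        have hTT : del (ins T) = T := by
          apply Subtype.ext
          simp [ins, del, ha, hb]
        have := hmem (ins T)
        simp only [P, ha', hb', if_true, hTT] at this
        have h2 := sub_mem (mul_mem (h0 B (by simp [B, hab.ne])) (h1 (ins T) ha' hb')) this
        rwa [sub_sub_cancel] at h2
    · exact h0 T ha
  · rw [aeval_X, hbw]
    by_cases ha : a ∈ T.1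
    · have hT : T.1 = insert a (T.1.erase a) := (Finset.insert_erase ha).symm
      have hT0 : a ∉ T.1.erase a := by simp
      by_cases hb : b ∈ T.1
      · have hE : T.1.erase a = insert b ((T.1.erase a).erase b) :=
          (Finset.insert_erase (by simp [hab.ne', hb])).symm
        set Y := (T.1.erase a).erase b with hY
        have hYa : a ∉ Y := by simp [hY]
        have hYb : b ∉ Y := by simp [hY]
        have hdel : (del T).1 = insert a Y := by
          simp only [del, ha, dif_pos, hY]
          rw [Finset.erase_right_comm, Finset.insert_erase (by simp [hab.ne, ha])]
        have hTw : sortedWord T.1 = FreeGroup.of a * (FreeGroup.of b * sortedWord Y) := by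
          rw [hT, sortedWord_insert (hamin _ hT0), hE, sortedWord_insert (hbmin _ hYa hYb)]
        simp only [P, ha, hb, if_true]
        rw [map_sub, map_mul, hX, hX, hX, hdel, sortedWord_insert (hamin _ hYa), hTw]
        simp only [B]
        rw [sortedWord_singleton, map_mul, map_mul, hta, htc b hab.ne', htw Y hYa]
        have := tr_mul_inv (genericRep n) (FreeGroup.of a * FreeGroup.of b) (FreeGroup.of b)
          (sortedWord Y)
        rw [mul_inv_cancel_right] at this
        rw [this]
        simp only [mul_assoc]
        ring
      · have hYb : b ∉ T.1.erase a := by simp [hb]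
        simp only [P, ha, hb, if_true, if_false]
        rw [hX]
        have hins : (ins T).1 = insert a (insert b (T.1.erase a)) := by
          rw [Finset.insert_comm, ← hT]
        set Y := T.1.erase a with hY
        have hab' : ∀ x ∈ insert b Y, a < x := by
          intro x hx
          rcases Finset.mem_insert.1 hx with rfl | hx
          · exact hab
          · exact hamin Y hT0 x hx
        rw [hins, hT, sortedWord_insert (hamin Y hT0), sortedWord_insert hab',
          sortedWord_insert (hbmin Y hT0 hYb), map_mul, hta, htw _ hT0, mul_assoc]
    · simp only [P, ha, if_false]
      rw [hX, htw _ ha]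

/-- The endomorphism permuting the letters by a signed permutation. -/
def signedPermHom (π : Equiv.Perm (Fin n)) (ε : Fin n → Bool) :
    FreeGroup (Fin n) →* FreeGroup (Fin n) :=
  FreeGroup.lift fun k => letter (π k, ε k)

lemma signedPermHom_comp (π : Equiv.Perm (Fin n)) (ε : Fin n → Bool) :
    (signedPermHom π.symm fun k => ε (π.symm k)).comp (signedPermHom π ε) = MonoidHom.id _ := by
  refine FreeGroup.ext_hom _ _ fun k => ?_
  rw [MonoidHom.comp_apply, signedPermHom, signedPermHom, FreeGroup.lift_apply_of]
  cases h : ε k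
  · rw [letter_false, map_inv, FreeGroup.lift_apply_of, Equiv.symm_apply_apply, h, letter_false]
    simp
  · rw [letter_true, FreeGroup.lift_apply_of, Equiv.symm_apply_apply, h, letter_true]
    simp

/-- The automorphism permuting the letters by a signed permutation. -/
def signedPerm (π : Equiv.Perm (Fin n)) (ε : Fin n → Bool) : MulAut (FreeGroup (Fin n)) :=
  MonoidHom.toMulEquiv (signedPermHom π ε) (signedPermHom π.symm fun k => ε (π.symm k))
    (signedPermHom_comp π ε) (by
      have := signedPermHom_comp π.symm fun k => ε (π.symm k)
      simpa using this)

lemma signedPerm_of (π : Equiv.Perm (Fin n)) (ε : Fin n → Bool) (k : Fin n) :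
    signedPerm π ε (FreeGroup.of k) = letter (π k, ε k) :=
  FreeGroup.lift_apply_of (f := fun k => letter (π k, ε k))

lemma exists_perm_apply_eq {a b i j : Fin n} (hab : a ≠ b) (hij : i ≠ j) :
    ∃ π : Equiv.Perm (Fin n), π a = i ∧ π b = j := by
  refine ⟨(Equiv.swap a i).trans (Equiv.swap (Equiv.swap a i b) j), ?_, ?_⟩
  · rw [Equiv.trans_apply, Equiv.swap_apply_left, Equiv.swap_apply_of_ne_of_ne _ hij]
    intro h
    apply hab
    apply (Equiv.swap a i).injective
    rw [Equiv.swap_apply_left, ← h]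
  · simp

lemma isLiftable_transvection (L M : Fin n × Bool) (h : L.1 ≠ M.1) :
    IsLiftable (transvection L M h) := by
  have hn : 2 ≤ n := by
    by_contra hn
    exact h (Fin.ext (by have := L.1.2; have := M.1.2; omega))
  let a : Fin n := ⟨0, by omega⟩
  let b : Fin n := ⟨1, by omega⟩
  have hab : a < b := Fin.mk_lt_mk.2 Nat.zero_lt_one
  have hall : ∀ c : Fin n, c = a ∨ b ≤ c := by
    intro c
    rcases Nat.eq_zero_or_pos c.1 with h0 | h0
    · exact Or.inl (Fin.ext h0)
    · exact Or.inr (Fin.le_def.2 h0)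
  obtain ⟨π, hπa, hπb⟩ := exists_perm_apply_eq hab.ne (Ne.symm h)
  -- The signs send `a` to `M⁻¹` and `b` to `L⁻¹`, so that `a ↦ ab` is carried to `M ↦ LM`.
  let ε : Fin n → Bool := fun k => if k = a then !M.2 else if k = b then !L.2 else true
  set s := signedPerm π ε with hs
  set t := transvection (b, false) (a, false) hab.ne' with ht
  have hsa : s (FreeGroup.of a) = (letter M)⁻¹ := by
    rw [hs, signedPerm_of, hπa, ← letter_flipLetter, flipLetter]
    simp [ε]
  have hsb : s (FreeGroup.of b) = (letter L)⁻¹ := by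
    rw [hs, signedPerm_of, hπb, ← letter_flipLetter, flipLetter]
    simp [ε, hab.ne']
  have hs' : s ∈ liftableSubgroup n :=
    isLiftable_of_letters s fun j => ⟨_, signedPerm_of π ε j⟩
  have ht' : t ∈ liftableSubgroup n := isLiftable_transvection_first hab hall
  have hta : t (FreeGroup.of a) = FreeGroup.of a * FreeGroup.of b := by
    have := transvection_letter (L := (b, false)) (M := (a, false)) hab.ne'
    rw [letter_false, letter_false, map_inv] at this
    rw [← inv_inj, this, mul_inv_rev]
  have hcomm : transvection L M h * s = s * t := by
    have : (transvection L M h * s).toMonoidHom = (s * t).toMonoidHom := by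
      refine FreeGroup.ext_hom _ _ fun k => ?_
      change transvection L M h (s (FreeGroup.of k)) = s (t (FreeGroup.of k))
      by_cases hka : k = a
      · rw [hka, hta, map_mul, hsa, hsb, map_inv, transvection_letter, mul_inv_rev]
      · rw [transvection_of_ne (M := (a, false)) hab.ne' hka]
        have hk : (π k) ≠ M.1 := fun h0 => hka (π.injective (h0.trans hπa.symm))
        rw [hs, signedPerm_of]
        exact transvectionHom_letter_of_ne _ hk
    exact MulEquiv.toMonoidHom_injective this
  have : transvection L M h = s * t * s⁻¹ := by rw [← hcomm, mul_inv_cancel_right]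
  have hmem : transvection L M h ∈ liftableSubgroup n :=
    this ▸ mul_mem (mul_mem hs' ht') (inv_mem hs')
  exact hmem

/-- The action of every automorphism of the free group on characters extends to an integral
polynomial automorphism of affine space. -/
theorem isLiftable (α : MulAut (FreeGroup (Fin n))) : IsLiftable α := by
  have := subgroup_eq_top_of_nielsen (liftableSubgroup n) isLiftable_of_letters
    isLiftable_transvection
  exact (this ▸ Subgroup.mem_top α : α ∈ liftableSubgroup n)

end Liftable

end
end FrickeCharacters

namespace FrickeCharacters

noncomputable section

open MvPolynomial

/-! ### Jacobians of polynomial automorphisms and the volume form. -/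

section Jacobian

variable {ι : Type} [Fintype ι] [DecidableEq ι]

lemma pderiv_aeval {R : Type} [CommRing R] (g : ι → MvPolynomial ι R) (p : MvPolynomial ι R)
    (j : ι) : pderiv j (aeval g p) = ∑ k, aeval g (pderiv k p) * pderiv j (g k) := by
  induction p using MvPolynomial.induction_on with
  | C a => simp [MvPolynomial.algebraMap_eq]
  | add p q hp hq => simp only [map_add, hp, hq, add_mul, Finset.sum_add_distrib]
  | mul_X p i hp =>
    simp only [map_mul, aeval_X, Derivation.leibniz, hp, smul_eq_mul, pderiv_X, map_add, add_mul,
      Finset.sum_add_distrib, Finset.mul_sum]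
    congr 1
    · rw [Finset.sum_eq_single i]
      · simp
      · intro k _ hk; simp [hk.symm]
      · simp
    · exact Finset.sum_congr rfl fun k _ => by ring

/-- The Jacobian matrix of an endomorphism of a polynomial ring. -/
def jacobianMatrix {R : Type} [CommRing R] (φ : MvPolynomial ι R →ₐ[R] MvPolynomial ι R) :
    Matrix ι ι (MvPolynomial ι R) :=
  Matrix.of fun i j => pderiv j (φ (X i))

/-- The chain rule applied to `φ (φ.symm (X i)) = X i` exhibits a left inverse of the Jacobian
matrix. -/
lemma isUnit_det_jacobianMatrix {R : Type} [CommRing R]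
    (φ : MvPolynomial ι R ≃ₐ[R] MvPolynomial ι R) :
    IsUnit (jacobianMatrix (φ : MvPolynomial ι R →ₐ[R] MvPolynomial ι R)).det := by
  have h : (φ : MvPolynomial ι R →ₐ[R] MvPolynomial ι R).toRingHom.mapMatrix
      (jacobianMatrix (φ.symm : MvPolynomial ι R →ₐ[R] MvPolynomial ι R))
        * jacobianMatrix (φ : MvPolynomial ι R →ₐ[R] MvPolynomial ι R) = 1 := by
    have hφ : (φ : MvPolynomial ι R →ₐ[R] MvPolynomial ι R) = aeval fun i => φ (X i) := by
      ext i; simp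
    ext1 i j
    have := pderiv_aeval (fun i => φ (X i)) (φ.symm (X i)) j
    rw [← hφ] at this
    simp only [AlgEquiv.coe_toAlgHom, AlgEquiv.apply_symm_apply, pderiv_X] at this
    rw [Matrix.mul_apply, Matrix.one_apply]
    refine Eq.trans this.symm ?_
    rw [Pi.single_apply]
  have h2 := congrArg Matrix.det h
  rw [Matrix.det_mul, Matrix.det_one] at h2
  exact IsUnit.of_mul_eq_one_right _ h2

lemma det_jacobianMatrix_int (φ : MvPolynomial ι ℤ ≃ₐ[ℤ] MvPolynomial ι ℤ) :
    (jacobianMatrix (φ : MvPolynomial ι ℤ →ₐ[ℤ] MvPolynomial ι ℤ)).det = 1 ∨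
      (jacobianMatrix (φ : MvPolynomial ι ℤ →ₐ[ℤ] MvPolynomial ι ℤ)).det = -1 := by
  obtain ⟨r, hr, h⟩ := MvPolynomial.isUnit_iff_eq_C_of_isReduced.1 (isUnit_det_jacobianMatrix φ)
  rcases Int.isUnit_iff.1 hr with rfl | rfl
  · left; simpa using h
  · right; simpa using h

/-- The complexification of an endomorphism of an integral polynomial ring. -/
def complexify {ι : Type} (φ : MvPolynomial ι ℤ →ₐ[ℤ] MvPolynomial ι ℤ) :
    MvPolynomial ι ℂ →ₐ[ℂ] MvPolynomial ι ℂ :=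
  aeval fun i => map (Int.castRingHom ℂ) (φ (X i))

lemma complexify_map {ι : Type} (φ : MvPolynomial ι ℤ →ₐ[ℤ] MvPolynomial ι ℤ) (p : MvPolynomial ι ℤ) :
    complexify φ (map (Int.castRingHom ℂ) p) = map (Int.castRingHom ℂ) (φ p) := by
  induction p using MvPolynomial.induction_on with
  | C a => simp [← MvPolynomial.algebraMap_eq, complexify]
  | add p q hp hq => simp only [map_add, hp, hq]
  | mul_X p i hp => simp only [map_mul, hp, map_X]; simp [complexify]

/-- The complexification of an automorphism of an integral polynomial ring. -/
def complexifyEquiv {ι : Type} (φ : MvPolynomial ι ℤ ≃ₐ[ℤ] MvPolynomial ι ℤ) :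
    MvPolynomial ι ℂ ≃ₐ[ℂ] MvPolynomial ι ℂ :=
  AlgEquiv.ofAlgHom (complexify φ) (complexify φ.symm)
    (by
      ext1 i
      rw [AlgHom.comp_apply]
      conv_lhs => rw [complexify.eq_def (φ.symm : _ →ₐ[ℤ] MvPolynomial ι ℤ), aeval_X, complexify_map]
      simp)
    (by
      ext1 i
      rw [AlgHom.comp_apply]
      conv_lhs => rw [complexify.eq_def (φ : _ →ₐ[ℤ] MvPolynomial ι ℤ), aeval_X, complexify_map]
      simp)

lemma complexifyEquiv_X {ι : Type} (φ : MvPolynomial ι ℤ ≃ₐ[ℤ] MvPolynomial ι ℤ) (i : ι) :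
    complexifyEquiv φ (X i) = map (Int.castRingHom ℂ) (φ (X i)) := by
  change complexify φ (X i) = _
  simp [complexify]

lemma jacobianDet_complexifyEquiv (φ : MvPolynomial ι ℤ ≃ₐ[ℤ] MvPolynomial ι ℤ) :
    jacobianDet (complexifyEquiv φ : MvPolynomial ι ℂ →ₐ[ℂ] MvPolynomial ι ℂ) = 1 ∨
      jacobianDet (complexifyEquiv φ : MvPolynomial ι ℂ →ₐ[ℂ] MvPolynomial ι ℂ) = -1 := by
  have h : jacobianDet (complexifyEquiv φ : MvPolynomial ι ℂ →ₐ[ℂ] MvPolynomial ι ℂ)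
      = map (Int.castRingHom ℂ)
        (jacobianMatrix (φ : MvPolynomial ι ℤ →ₐ[ℤ] MvPolynomial ι ℤ)).det := by
    rw [jacobianDet, RingHom.map_det]
    congr 1
    ext1 i j
    change pderiv j (complexifyEquiv φ (X i)) = map (Int.castRingHom ℂ) (pderiv j (φ (X i)))
    rw [complexifyEquiv_X, pderiv_map]
  rcases det_jacobianMatrix_int φ with h1 | h1
  · left; rw [h, h1, map_one]
  · right; rw [h, h1, map_neg, map_one]

lemma hasFDerivAt_eval (p : MvPolynomial ι ℂ) (x : ι → ℂ) :
    HasFDerivAt (fun x => eval x p)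
      (∑ j, eval x (pderiv j p) • (ContinuousLinearMap.proj j : (ι → ℂ) →L[ℂ] ℂ)) x := by
  induction p using MvPolynomial.induction_on with
  | C a =>
    simp only [eval_C, pderiv_C, map_zero]
    refine (hasFDerivAt_const (𝕜 := ℂ) a x).congr_fderiv ?_
    ext v
    simp
  | add p q hp hq =>
    simp only [map_add]
    refine (hp.add hq).congr_fderiv ?_
    ext v
    simp [add_mul, Finset.sum_add_distrib]
  | mul_X p i hp =>
    have h1 : HasFDerivAt (fun x : ι → ℂ => x i)
        (ContinuousLinearMap.proj i : (ι → ℂ) →L[ℂ] ℂ) x := hasFDerivAt_apply i x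
    simp only [map_mul, eval_X]
    refine (hp.mul h1).congr_fderiv (ContinuousLinearMap.ext fun v => ?_)
    have h2 (j : ι) : eval x (pderiv j (p * X i)) * v j
        = eval x p * (if i = j then v j else 0) + x i * (eval x (pderiv j p) * v j) := by
      rw [Derivation.leibniz, pderiv_X, Pi.single_apply]
      split_ifs <;> simp_all <;> ring
    have h3 : ∑ j, eval x (pderiv j (p * X i)) * v j
        = eval x p * v i + x i * ∑ j, eval x (pderiv j p) * v j := by
      simp only [h2, Finset.sum_add_distrib, ← Finset.mul_sum, Finset.sum_ite_eq,
        Finset.mem_univ, if_true]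
    simpa using h3.symm

lemma preservesVolumeModulus_of_jacobianDet (φ : MvPolynomial ι ℂ →ₐ[ℂ] MvPolynomial ι ℂ)
    (h : jacobianDet φ = 1 ∨ jacobianDet φ = -1) : PreservesVolumeModulus (polyMap φ) := by
  have hd : ∀ x, HasFDerivAt (polyMap φ)
      (LinearMap.toContinuousLinearMap (Matrix.toLin'
        ((jacobianMatrix φ).map (eval x)))) x := by
    intro x
    rw [hasFDerivAt_pi']
    intro i
    refine (hasFDerivAt_eval (φ (X i)) x).congr_fderiv ?_
    ext v
    simp [jacobianMatrix, Matrix.mulVec, dotProduct]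
  refine ⟨fun x => (hd x).differentiableAt, fun x v => ?_⟩
  have h1 : (fun i => fderiv ℂ (polyMap φ) x (v i))
      = (Matrix.toLin' ((jacobianMatrix φ).map (eval x))) ∘ v := by
    funext i
    rw [(hd x).fderiv]
    rfl
  rw [h1, standardVolume, Module.Basis.det_comp, LinearMap.det_toLin', norm_mul]
  have h2 : ((jacobianMatrix φ).map (eval x)).det = eval x (jacobianDet φ) := by
    rw [jacobianDet, RingHom.map_det]; rfl
  have h3 : ‖((jacobianMatrix φ).map (eval x)).det‖ = 1 := by
    rw [h2]
    rcases h with h | h <;> rw [h] <;> simp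
  rw [h3, one_mul]

end Jacobian
end
end FrickeCharacters

namespace FrickeCharacters

noncomputable section

open MvPolynomial

/-! ### The Fricke variety and the action of outer automorphisms. -/

lemma card_basicIndex (n : ℕ) : Fintype.card (BasicIndex n) = 2 ^ n - 1 := by
  rw [Fintype.card_subtype]
  have h : (Finset.univ.filter fun S : Finset (Fin n) => S.Nonempty)
      = Finset.univ.erase ∅ := by
    ext S
    simp [Finset.nonempty_iff_ne_empty]
  rw [h, Finset.card_erase_of_mem (Finset.mem_univ _)]
  simp

/-- The character of the representation `specialRep y`. -/
def specialCharacter {n : ℕ} (y : Fin n × Fin 4 → ℂ) : CharacterSet n :=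
  ⟨character (specialRep y), _, rfl⟩

lemma exists_specialCharacter {n : ℕ} (χ : CharacterSet n) : ∃ y, χ = specialCharacter y := by
  obtain ⟨χ, ρ, rfl⟩ := χ
  obtain ⟨y, rfl⟩ := exists_specialRep ρ
  exact ⟨y, rfl⟩

lemma aeval_horowitz_specialCharacter {n : ℕ} (y : Fin n × Fin 4 → ℂ)
    (p : MvPolynomial (BasicIndex n) ℤ) :
    aeval (horowitz n (specialCharacter y)) p = aeval y (traceEval n p) :=
  aeval_tr_specialRep y p

lemma exists_aeval_horowitz_eq {n : ℕ} (w : FreeGroup (Fin n)) :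
    ∃ p : MvPolynomial (BasicIndex n) ℤ, ∀ χ : CharacterSet n,
      χ.1 w = aeval (horowitz n χ) p := by
  obtain ⟨p, hp⟩ := exists_traceEval_eq w
  refine ⟨p, fun χ => ?_⟩
  obtain ⟨y, rfl⟩ := exists_specialCharacter χ
  rw [aeval_horowitz_specialCharacter, hp]
  exact tr_specialRep y w

lemma horowitz_injective (n : ℕ) : Function.Injective (horowitz n) := by
  intro χ ψ h
  apply Subtype.ext
  funext w
  obtain ⟨p, hp⟩ := exists_aeval_horowitz_eq w
  rw [hp, hp, h]

lemma mem_relationIdeal_iff {n : ℕ} {p : MvPolynomial (BasicIndex n) ℤ} :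
    p ∈ relationIdeal n ↔ ∀ χ, aeval (horowitz n χ) p = 0 := by
  have h (χ : CharacterSet n) : (aeval (fun (S : BasicIndex n) (χ : CharacterSet n) =>
      horowitz n χ S) p : CharacterSet n → ℂ) χ = aeval (horowitz n χ) p := by
    have := DFunLike.congr_fun (comp_aeval
      (fun (S : BasicIndex n) (χ : CharacterSet n) => horowitz n χ S)
      (Pi.evalAlgHom ℤ (fun _ : CharacterSet n => ℂ) χ)) p
    exact this
  rw [relationIdeal, RingHom.mem_ker]
  constructor
  · intro hp χ
    rw [← h]
    exact congrFun hp χ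
  · intro hp
    funext χ
    exact (h χ).trans (hp χ)

lemma eq_zero_of_forall_aeval {σ : Type} {q : MvPolynomial σ ℤ}
    (h : ∀ y : σ → ℂ, aeval y q = 0) : q = 0 := by
  apply map_injective (Int.castRingHom ℂ) Int.cast_injective
  rw [map_zero]
  refine MvPolynomial.funext fun y => ?_
  rw [eval_map, map_zero, ← h y]
  rfl

/-- Every character has parameters in `ℂ`, and an integral polynomial vanishing at all complex
points is zero. Thus relations on complex characters are identities between generic traces. -/
lemma mem_relationIdeal_iff_traceEval {n : ℕ} {p : MvPolynomial (BasicIndex n) ℤ} :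
    p ∈ relationIdeal n ↔ traceEval n p = 0 := by
  rw [mem_relationIdeal_iff]
  constructor
  · intro h
    refine eq_zero_of_forall_aeval fun y => ?_
    rw [← aeval_horowitz_specialCharacter, h]
  · intro h χ
    obtain ⟨y, rfl⟩ := exists_specialCharacter χ
    rw [aeval_horowitz_specialCharacter, h, map_zero]

lemma mem_frickeVariety_iff {n : ℕ} {x : BasicIndex n → ℂ} :
    x ∈ frickeVariety n ↔ ∀ p, traceEval n p = 0 → aeval x p = 0 := by
  have key (p : MvPolynomial (BasicIndex n) ℤ) :
      aeval x (map (Int.castRingHom ℂ) p) = aeval x p := by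
    rw [aeval_def, eval₂_map]; rfl
  rw [frickeVariety, mem_zeroLocus_iff]
  constructor
  · intro h p hp
    rw [← key]
    exact h _ (Ideal.mem_map_of_mem _ (mem_relationIdeal_iff_traceEval.2 hp))
  · intro h q hq
    have : (relationIdeal n).map (MvPolynomial.map (σ := BasicIndex n) (Int.castRingHom ℂ))
        ≤ RingHom.ker (aeval x : MvPolynomial (BasicIndex n) ℂ →ₐ[ℂ] ℂ) := by
      rw [Ideal.map_le_iff_le_comap]
      intro p hp
      rw [Ideal.mem_comap, RingHom.mem_ker, key]
      exact h p (mem_relationIdeal_iff_traceEval.1 hp)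
    exact this hq

lemma horowitz_mem_frickeVariety {n : ℕ} (χ : CharacterSet n) :
    horowitz n χ ∈ frickeVariety n :=
  mem_frickeVariety_iff.2 fun _ hp =>
    mem_relationIdeal_iff.1 (mem_relationIdeal_iff_traceEval.2 hp) χ

/-- Evaluation at `x` kills the relations, so it factors through the ring of generic traces, viewed
inside an algebraically closed field; `exists_rep_of_trace_hom` turns the factor into a
representation. -/
lemma exists_horowitz_eq {n : ℕ} {x : BasicIndex n → ℂ} (hx : x ∈ frickeVariety n) :
    ∃ χ, horowitz n χ = x := by
  rw [mem_frickeVariety_iff] at hx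
  let K := AlgebraicClosure (FractionRing (GenericRing n))
  let ι : GenericRing n →+* K :=
    (algebraMap (FractionRing (GenericRing n)) K).comp (algebraMap _ _)
  have hι : Function.Injective ι :=
    (algebraMap (FractionRing (GenericRing n)) K).injective.comp
      (IsFractionRing.injective (GenericRing n) (FractionRing (GenericRing n)))
  let θ : MvPolynomial (BasicIndex n) ℤ →+* K := ι.comp (traceEval n : _ →+* GenericRing n)
  have hθ (p : MvPolynomial (BasicIndex n) ℤ) : θ p = ι (traceEval n p) := rfl
  have hker : RingHom.ker θ.rangeRestrict
      ≤ RingHom.ker (aeval x : MvPolynomial (BasicIndex n) ℤ →ₐ[ℤ] ℂ).toRingHom := by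
    intro p hp
    rw [RingHom.mem_ker] at hp ⊢
    refine hx p (hι ?_)
    rw [map_zero, ← hθ]
    exact congrArg Subtype.val hp
  let φ : θ.range →+* ℂ := RingHom.liftOfSurjective θ.rangeRestrict θ.rangeRestrict_surjective
    ⟨(aeval x : MvPolynomial (BasicIndex n) ℤ →ₐ[ℤ] ℂ).toRingHom, hker⟩
  have hφ (p : MvPolynomial (BasicIndex n) ℤ) : φ (θ.rangeRestrict p) = aeval x p :=
    RingHom.liftOfRightInverse_comp_apply _ _ _ ⟨_, hker⟩ _
  let ρ : FreeGroup (Fin n) →* Matrix.SpecialLinearGroup (Fin 2) K :=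
    (Matrix.SpecialLinearGroup.map ι).comp (genericRep n)
  have hρ (w : FreeGroup (Fin n)) : (ρ w).1.trace = ι (tr (genericRep n) w) := by
    simp [ρ, tr, Matrix.trace_fin_two]
  have hR (w : FreeGroup (Fin n)) : (ρ w).1.trace ∈ θ.range := by
    obtain ⟨p, hp⟩ := exists_traceEval_eq w
    exact ⟨p, by rw [hρ, hθ, hp]⟩
  obtain ⟨ρ', hρ'⟩ := exists_rep_of_trace_hom θ.range φ ρ hR
  refine ⟨⟨character ρ', ρ', rfl⟩, funext fun T => ?_⟩
  have h1 := hφ (X T)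
  rw [aeval_X] at h1
  rw [← h1]
  refine (hρ' (basicWord T)).trans (congrArg φ (Subtype.ext ?_))
  change (ρ (basicWord T)).1.trace = θ (X T)
  rw [hρ, hθ, traceEval, aeval_X]

lemma range_horowitz (n : ℕ) : Set.range (horowitz n) = frickeVariety n :=
  Set.Subset.antisymm (Set.range_subset_iff.2 horowitz_mem_frickeVariety)
    fun _ hx => exists_horowitz_eq hx

/-- The complex polynomial in the entries of the generic representation obtained by substituting
the traces of the basic words. -/
def complexTraceEval (n : ℕ) :
    MvPolynomial (BasicIndex n) ℂ →ₐ[ℂ] MvPolynomial (Fin n × Fin 4) ℂ :=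
  aeval fun T => map (Int.castRingHom ℂ) (tr (genericRep n) (basicWord T))

lemma eval_horowitz_specialCharacter {n : ℕ} (y : Fin n × Fin 4 → ℂ)
    (p : MvPolynomial (BasicIndex n) ℂ) :
    aeval (horowitz n (specialCharacter y)) p = eval y (complexTraceEval n p) := by
  have h : (aeval y : MvPolynomial (Fin n × Fin 4) ℂ →ₐ[ℂ] ℂ).comp (complexTraceEval n)
      = aeval (horowitz n (specialCharacter y)) := by
    ext T
    rw [AlgHom.comp_apply, complexTraceEval, aeval_X, aeval_X, aeval_def, eval₂_map]
    exact (tr_specialRep y (basicWord T)).symm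
  rw [← h, AlgHom.comp_apply, aeval_eq_eval]

/-- The variety is the image of an affine space: polynomials from `I` and `J` not vanishing on it
pull back to nonzero polynomials, whose product is nonzero somewhere. -/
lemma isIrreducibleAffineVariety_frickeVariety (n : ℕ) :
    IsIrreducibleAffineVariety (frickeVariety n) := by
  refine ⟨⟨_, rfl⟩, ⟨_, horowitz_mem_frickeVariety (specialCharacter 0)⟩, fun I J hIJ => ?_⟩
  by_contra! h
  have key (I : Ideal (MvPolynomial (BasicIndex n) ℂ))
      (hI : ¬ frickeVariety n ⊆ zeroLocus ℂ I) : ∃ p ∈ I, complexTraceEval n p ≠ 0 := by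
    obtain ⟨x, hx, hxI⟩ := Set.not_subset.1 hI
    rw [mem_zeroLocus_iff] at hxI
    push Not at hxI
    obtain ⟨p, hp, hpx⟩ := hxI
    obtain ⟨χ, rfl⟩ := exists_horowitz_eq hx
    obtain ⟨y, rfl⟩ := exists_specialCharacter χ
    refine ⟨p, hp, fun h0 => hpx ?_⟩
    rw [eval_horowitz_specialCharacter, h0, map_zero]
  obtain ⟨p, hp, hp0⟩ := key I h.1
  obtain ⟨q, hq, hq0⟩ := key J h.2
  refine mul_ne_zero hp0 hq0 (MvPolynomial.funext fun y => ?_)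
  rw [map_mul, map_zero, ← eval_horowitz_specialCharacter, ← eval_horowitz_specialCharacter]
  rcases hIJ (horowitz_mem_frickeVariety (specialCharacter y)) with h1 | h1
  · rw [mem_zeroLocus_iff.1 h1 p hp, zero_mul]
  · rw [mem_zeroLocus_iff.1 h1 q hq, mul_zero]

lemma range_aeval_horowitz (n : ℕ) :
    (aeval (fun (S : BasicIndex n) (χ : CharacterSet n) => horowitz n χ S) :
      MvPolynomial (BasicIndex n) ℂ →ₐ[ℂ] (CharacterSet n → ℂ)).range = characterRing n := by
  apply le_antisymm
  · rw [← Algebra.adjoin_range_eq_range_aeval]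
    refine Algebra.adjoin_mono ?_
    rintro _ ⟨S, rfl⟩
    exact ⟨basicWord S, rfl⟩
  · refine Algebra.adjoin_le ?_
    rintro _ ⟨w, rfl⟩
    obtain ⟨p, hp⟩ := exists_aeval_horowitz_eq w
    refine ⟨map (Int.castRingHom ℂ) p, funext fun χ => ?_⟩
    have := DFunLike.congr_fun (comp_aeval (R := ℂ)
      (fun (S : BasicIndex n) (χ : CharacterSet n) => horowitz n χ S)
      (Pi.evalAlgHom ℂ (fun _ : CharacterSet n => ℂ) χ)) (map (Int.castRingHom ℂ) p)
    refine (this.trans ?_).trans (hp χ).symm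
    rw [aeval_def, eval₂_map]
    rfl

/-- The permutation of the characters induced by an automorphism of the free group. -/
def characterPerm {n : ℕ} (α : MulAut (FreeGroup (Fin n))) : Equiv.Perm (CharacterSet n) where
  toFun χ := ⟨χ.1 ∘ α, by
    obtain ⟨ρ, hρ⟩ := χ.2
    exact ⟨ρ.comp α.toMonoidHom, by rw [← hρ]; rfl⟩⟩
  invFun χ := ⟨χ.1 ∘ α.symm, by
    obtain ⟨ρ, hρ⟩ := χ.2
    exact ⟨ρ.comp α.symm.toMonoidHom, by rw [← hρ]; rfl⟩⟩
  left_inv χ := by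
    apply Subtype.ext
    funext w
    exact congrArg χ.1 (α.apply_symm_apply w)
  right_inv χ := by
    apply Subtype.ext
    funext w
    exact congrArg χ.1 (α.symm_apply_apply w)

lemma characterSet_conj {n : ℕ} (χ : CharacterSet n) (g w : FreeGroup (Fin n)) :
    χ.1 (g * w * g⁻¹) = χ.1 w := by
  obtain ⟨χ, ρ, rfl⟩ := χ
  exact tr_conj ρ g w

/-- Two representatives differ by a conjugation, which characters do not see. -/
lemma characterPerm_apply_of_eq {n : ℕ} {α β : MulAut (FreeGroup (Fin n))}
    (h : (β : OuterAut n) = (α : OuterAut n)) (χ : CharacterSet n) (w : FreeGroup (Fin n)) :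
    (characterPerm α χ).1 w = χ.1 (β w) := by
  obtain ⟨g, hg⟩ := QuotientGroup.eq.1 h
  have h1 : α w = β (g * w * g⁻¹) := by
    have := DFunLike.congr_fun (mul_inv_cancel_left β α) w
    rw [← this, ← hg]
    rfl
  change χ.1 (α w) = _
  rw [h1, map_mul, map_mul, map_inv, characterSet_conj]

lemma comp_mem_characterRing {n : ℕ} {t : CharacterSet n → CharacterSet n}
    {β : FreeGroup (Fin n) → FreeGroup (Fin n)} (ht : ∀ χ w, (t χ).1 w = χ.1 (β w))
    {f : CharacterSet n → ℂ} (hf : f ∈ characterRing n) : f ∘ t ∈ characterRing n := by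
  induction hf using Algebra.adjoin_induction with
  | mem f hf =>
    obtain ⟨w, rfl⟩ := hf
    exact Algebra.subset_adjoin ⟨β w, funext fun χ => (ht χ w).symm⟩
  | algebraMap r => exact (characterRing n).algebraMap_mem r
  | add f g _ _ hf hg => exact (characterRing n).add_mem hf hg
  | mul f g _ _ hf hg => exact (characterRing n).mul_mem hf hg

lemma isVarietyAut_characterPerm {n : ℕ} (α : MulAut (FreeGroup (Fin n))) :
    IsVarietyAut (characterPerm α) := fun _ =>
  ⟨comp_mem_characterRing (β := α) fun _ _ => rfl,
    comp_mem_characterRing (β := α.symm) fun _ _ => rfl⟩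

end
end FrickeCharacters

open FrickeCharacters in
theorem theorem1p1 (n : ℕ) :
    -- the ambient space is `ℂ ^ (2 ^ n - 1)`
    Fintype.card (BasicIndex n) = 2 ^ n - 1 ∧
    -- the Horowitz map is an embedding onto the Fricke variety, which is irreducible
    Function.Injective (horowitz n) ∧
    Set.range (horowitz n) = frickeVariety n ∧
    IsIrreducibleAffineVariety (frickeVariety n) ∧
    (MvPolynomial.aeval (fun (S : BasicIndex n) (χ : CharacterSet n) => horowitz n χ S) :
      MvPolynomial (BasicIndex n) ℂ →ₐ[ℂ] (CharacterSet n → ℂ)).range = characterRing n ∧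
    -- every outer automorphism induces an automorphism of the variety, and it extends
    ∀ σ : OuterAut n, ∃ τ : Equiv.Perm (CharacterSet n),
      (∀ α : MulAut (FreeGroup (Fin n)), (α : OuterAut n) = σ →
        ∀ (χ : CharacterSet n) (w : FreeGroup (Fin n)), (τ χ).1 w = χ.1 (α w)) ∧
      IsVarietyAut τ ∧
      ∃ φ : MvPolynomial (BasicIndex n) ℂ ≃ₐ[ℂ] MvPolynomial (BasicIndex n) ℂ,
        (∀ χ : CharacterSet n,
          polyMap (φ : MvPolynomial (BasicIndex n) ℂ →ₐ[ℂ] MvPolynomial (BasicIndex n) ℂ)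
            (horowitz n χ) = horowitz n (τ χ)) ∧
        (jacobianDet
            (φ : MvPolynomial (BasicIndex n) ℂ →ₐ[ℂ] MvPolynomial (BasicIndex n) ℂ) = 1 ∨
          jacobianDet
            (φ : MvPolynomial (BasicIndex n) ℂ →ₐ[ℂ] MvPolynomial (BasicIndex n) ℂ) = -1) ∧
        PreservesVolumeModulus
          (polyMap (φ : MvPolynomial (BasicIndex n) ℂ →ₐ[ℂ] MvPolynomial (BasicIndex n) ℂ)) := by
  refine ⟨card_basicIndex n, horowitz_injective n, range_horowitz n,
    isIrreducibleAffineVariety_frickeVariety n, range_aeval_horowitz n, fun σ => ?_⟩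
  obtain ⟨α, rfl⟩ := QuotientGroup.mk_surjective σ
  obtain ⟨φ, hφ⟩ := isLiftable α
  refine ⟨characterPerm α, fun β hβ => characterPerm_apply_of_eq hβ,
    isVarietyAut_characterPerm α, complexifyEquiv φ, fun χ => funext fun T => ?_,
    jacobianDet_complexifyEquiv φ,
    preservesVolumeModulus_of_jacobianDet _ (jacobianDet_complexifyEquiv φ)⟩
  obtain ⟨χ, ρ, rfl⟩ := χ
  refine Eq.trans ?_ (hφ ρ T)
  change MvPolynomial.eval _ (complexifyEquiv φ (MvPolynomial.X T)) = _
  rw [complexifyEquiv_X, MvPolynomial.eval_map]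
  rfl
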